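/- Let $n\ge 1$ and let $T=(V,E)$ be a tree on $n$ vertices. Fix a root $r\in V$ and a linear order of the vertices, and write every edge as an arc $(i,j)\in E$ directed away from the root. Let $d_i$ be the number of children of $i$, let $i(1),\dots,i(d_i)$ be the children of $i$ in the fixed order, and, for $0\le s\le d_i$, let $N(i,s)$ be the number of vertices of the sub-tree $T(i,s)$ that consists of $i$ and of its first $s$ children with all their descendants. Let $N_i=N(i,d_i)$. Let $k$ be an integer. Let $p_i$ $(i\in V)$ and $p_{ij}$ $((i,j)\in E)$ be univariate and bivariate Bernoulli probabilities, that is, $0\le p_i\le 1$ for every vertex and $p_{ij}$, $p_i-p_{ij}$, $p_j-p_{ij}$, $1-p_i-p_j+p_{ij}\ge 0$ for every edge. Let $\Theta$ be the set of all probability distributions $\theta$ of a random vector $\tilde c\in\{0,1\}^V$ with $\mathbb P_\theta(\tilde c_i=1)=p_i$ for all $i\in V$ and $\mathbb P_\theta(\tilde c_i=1,\tilde c_j=1)=p_{ij}$ for all $(i,j)\in E$, and let $$U(k)=\max_{\theta\in\Theta}\ \mathbb P_\theta\Big(\sum_{i\in V}\tilde c_i\ge k\Big).$$ Consider the following linear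 program in the real variables $\lambda$, $z$, $\alpha_i,\tau_i$ $(i\in V)$, $\beta_{ij},\Delta_{ij},\eta_{ij},\gamma_{ij},\chi_{ij}$ $((i,j)\in E)$ and $x_{i,s,y,t}$ $(i\in V,\ 0\le s\le d_i,\ y\in\{0,1\},\ 0\le t\le n)$; all indices are integers: $$\begin{aligned} U^*_k=\min\ & \lambda+\sum_{i\in V}\alpha_ip_i+\sum_{(i,j)\in E}\beta_{ij}p_{ij}\\ \text{s.t. } & \lambda-\sum_{(i,j)\in E}(\Delta_{ij}+\chi_{ij})-\sum_{i\in V}\tau_i\ge 0,\\ & \sum_{j:(i,j)\in E}(\Delta_{ij}-\eta_{ij})+\sum_{j:(j,i)\in E}(\Delta_{ji}-\gamma_{ji})+\tau_i+\alpha_i\ge 0 && (i\in V),\\ & \eta_{ij}+\gamma_{ij}-\Delta_{ij}+\chi_{ij}+\beta_{ij}\ge 0 && ((i,j)\in E),\\ & \lambda+z\ge 1,\\ & x_{r,d_r,0,t}-z\ge 0,\quad x_{r,d_r,1,t}-z\ge 0 && (0\le t\le n,\ t\ge k),\\ & x_{i,s,0,0}=0,\quad x_{i,s,1,1}-\alpha_i=0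 && (i\in V,\ 0\le s\le d_i),\\ & \boldsymbol\eta,\boldsymbol\gamma,\boldsymbol\Delta,\boldsymbol\tau,\boldsymbol\chi\ge 0; \end{aligned}$$ for every $i$ with $d_i\ge 1$, with $j=i(1)$, $$\begin{aligned} & x_{j,d_j,0,t}-x_{i,1,0,t}\ge 0 && (0\le t\le N(i,1)-2),\\ & x_{j,d_j,1,t}-x_{i,1,0,t}\ge 0 && (1\le t\le N(i,1)-1),\\ & x_{j,d_j,0,t-1}-x_{i,1,1,t}+\alpha_i\ge 0 && (1\le t\le N(i,1)-1),\\ & x_{j,d_j,1,t-1}-x_{i,1,1,t}+\alpha_i+\beta_{ij}\ge 0 && (2\le t\le N(i,1)); \end{aligned}$$ and for every $i$ with $d_i\ge 2$ and every $2\le s\le d_i$, with $j=i(s)$, $$\begin{aligned} & x_{i,s-1,0,t-a}+x_{j,d_j,0,a}-x_{i,s,0,t}\ge 0 && (0\le t\le N(i,s)-2,\ \max(0,t-N(i,s-1)+1)\le a\le\min(N_j-1,t)),\\ & x_{i,s-1,0,t-a}+x_{j,d_j,1,a}-x_{i,s,0,t}\ge 0 && (1\le t\le N(i,s)-1,\ \max(1,t-N(i,s-1)+1)\le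 a\le\min(N_j,t)),\\ & x_{i,s-1,1,t-a}+x_{j,d_j,0,a}-x_{i,s,1,t}\ge 0 && (1\le t\le N(i,s)-1,\ \max(0,t-N(i,s-1))\le a\le\min(N_j-1,t-1)),\\ & x_{i,s-1,1,t-a}+x_{j,d_j,1,a}-x_{i,s,1,t}+\beta_{ij}\ge 0 && (2\le t\le N(i,s),\ \max(1,t-N(i,s-1))\le a\le\min(N_j,t-1)). \end{aligned}$$ Then $\Theta$ is nonempty, both optima are attained, and $U(k)=U^*_k$. Moreover, the linear program has $O(n^2)$ variables and $O(n^3)$ constraints: there is an absolute constant $C$ such that for every tree, root, vertex order and $k$ the numbers of variables and constraints are at most $Cn^2$ and $Cn^3$. -/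

import Mathlib

universe u

namespace TreeBound

/-! ### Linear programs -/

/-- A linear form in real variables named by `ι`. -/
abbrev Form (ι : Type*) : Type _ := (ι → ℝ) →ₗ[ℝ] ℝ

/-- One linear constraint: `f ≥ b` or `f = b`. -/
inductive LinConstraint (ι : Type*) where
  | ge (f : Form ι) (b : ℝ) : LinConstraint ι
  | eq (f : Form ι) (b : ℝ) : LinConstraint ι

/-- The point `v` satisfies the constraint. -/
def LinConstraint.Holds {ι : Type*} (v : ι → ℝ) : LinConstraint ι → Prop
  | .ge f b => b ≤ f v
  | .eq f b => f v = b

/-- A linear minimization program with variables named by `ι` and constraints named by `κ`. -/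
structure LinProgram (ι κ : Type*) where
  /-- the form to be minimized -/
  objective : Form ι
  /-- the constraints -/
  constraint : κ → LinConstraint ι

/-- The feasible points of a linear program. -/
def LinProgram.feasible {ι κ : Type*} (P : LinProgram ι κ) : Set (ι → ℝ) :=
  {v | ∀ c, (P.constraint c).Holds v}

/-- `m` is the optimal value of the minimization program `P` (and it is attained). -/
def LinProgram.IsOptimalValue {ι κ : Type*} (P : LinProgram ι κ) (m : ℝ) : Prop :=
  IsLeast (P.objective '' P.feasible) m

/-! ### Bernoulli random vectors with given univariate and bivariate marginals -/

section Distributions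

variable {V : Type u} [Fintype V] [LinearOrder V]

/-- Probability of the event `A` under the distribution on `{0,1}^V` with point masses `θ`. -/
noncomputable def prob (θ : (V → Bool) → ℝ) (A : Set (V → Bool)) : ℝ :=
  ∑ c, A.indicator θ c

/-- The set of the probability distributions on `{0,1}^V` with `P(c_i = 1) = p_i` for every
vertex and `P(c_i = 1, c_j = 1) = p_ij` for every edge. -/
def Theta (G : SimpleGraph V) (p : V → ℝ) (q : Sym2 V → ℝ) : Set ((V → Bool) → ℝ) :=
  {θ | θ ∈ stdSimplex ℝ (V → Bool) ∧
    (∀ i, prob θ {c | c i = true} = p i) ∧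
    (∀ i j, G.Adj i j → prob θ {c | c i = true ∧ c j = true} = q s(i, j))}

/-- The event that at least `k` of the coordinates are `1`. -/
def atLeast (V : Type u) [Fintype V] (k : ℤ) : Set (V → Bool) :=
  {c | k ≤ ∑ i, ((c i).toNat : ℤ)}

/-- `u` is the largest value of `P(∑ c_i ≥ k)` over the distributions with the given marginals
(and it is attained). -/
def IsTightUpperBound (G : SimpleGraph V) (p : V → ℝ) (q : Sym2 V → ℝ) (k : ℤ) (u : ℝ) : Prop :=
  IsGreatest ((fun θ => prob θ (atLeast V k)) '' Theta G p q) u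

/-- The given numbers are univariate and bivariate Bernoulli probabilities: `p_i ∈ [0,1]`, and for
every edge the four numbers `P(1,1) = p_ij`, `P(1,0) = p_i - p_ij`, `P(0,1) = p_j - p_ij` and
`P(0,0) = 1 - p_i - p_j + p_ij` are nonnegative. -/
def AreMarginals (G : SimpleGraph V) (p : V → ℝ) (q : Sym2 V → ℝ) : Prop :=
  (∀ i, 0 ≤ p i ∧ p i ≤ 1) ∧
  (∀ i j, G.Adj i j → 0 ≤ q s(i, j) ∧ 0 ≤ p i - q s(i, j) ∧ 0 ≤ p j - q s(i, j) ∧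
    0 ≤ 1 - p i - p j + q s(i, j))

end Distributions

/-! ### Rooted trees -/

section Rooted

variable {V : Type u} [Fintype V] [LinearOrder V] (G : SimpleGraph V) (r : V)

/-- In the tree `G` rooted at `r`, the vertex `j` is a child of `i`: an edge leads from `i` one
step farther from the root. -/
def IsChild (i j : V) : Prop := G.Adj i j ∧ G.dist r j = G.dist r i + 1

open Classical in
/-- The children of `i`, in the fixed order of the vertices. -/
noncomputable def children (i : V) : List V :=
  (Finset.univ.filter fun j => IsChild G r i j).sort (· ≤ ·)

/-- The out-degree `d_i`. -/
noncomputable def deg (i : V) : ℕ := (children G r i).length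

/-- The `s`-th child `i(s)` of `i`, for `1 ≤ s ≤ d_i`. -/
noncomputable def child (i : V) (s : ℕ) (h1 : 1 ≤ s) (h2 : s ≤ deg G r i) : V :=
  (children G r i)[s - 1]'(by unfold deg at h2; omega)

theorem isChild_child (i : V) (s : ℕ) (h1 : 1 ≤ s) (h2 : s ≤ deg G r i) :
    IsChild G r i (child G r i s h1 h2) := by
  classical
  have h : child G r i s h1 h2 ∈ children G r i := List.getElem_mem _
  simpa [children] using h

/-- The vertex set `V(i,s)` of the sub-tree `T(i,s)`: the vertex `i` and the first `s` of its
children with all their descendants. -/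
def subtree (i : V) (s : ℕ) : Set V :=
  {j | j = i ∨ ∃ c ∈ (children G r i).take s, Relation.ReflTransGen (IsChild G r) c j}

/-- `N(i,s)`, the number of vertices of `T(i,s)`. -/
noncomputable def size (i : V) (s : ℕ) : ℕ := (subtree G r i s).ncard

/-- `N(i,d_i)`, the number of vertices of the whole sub-tree rooted at `i`. -/
noncomputable def fullSize (i : V) : ℕ := size G r i (deg G r i)

theorem size_le (i : V) (s : ℕ) : size G r i s ≤ Fintype.card V := by
  rw [← Nat.card_eq_fintype_card]
  exact Set.ncard_le_card _

theorem one_le_card (i : V) : 1 ≤ Fintype.card V :=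
  Fintype.card_pos_iff.mpr ⟨i⟩

/-- The edges of the rooted tree, each once and directed away from the root. -/
def Arc : Type u := {e : V × V // IsChild G r e.1 e.2}

noncomputable instance : Fintype (Arc G r) := by
  classical
  unfold Arc
  infer_instance

/-- The tail (parent end) of an arc. -/
def Arc.tail {G : SimpleGraph V} {r : V} (e : Arc G r) : V := e.1.1

/-- The head (child end) of an arc. -/
def Arc.head {G : SimpleGraph V} {r : V} (e : Arc G r) : V := e.1.2

/-- The arc `(i, i(s))`. -/
noncomputable def arcTo (i : V) (s : ℕ) (h1 : 1 ≤ s) (h2 : s ≤ deg G r i) : Arc G r :=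
  ⟨(i, child G r i s h1 h2), isChild_child G r i s h1 h2⟩

/-! ### The compact linear program -/

/-- The decision variables. In `x i s y t` the Boolean `y` stands for `0` or `1`. -/
inductive Var : Type u where
  | lam : Var
  | z : Var
  | alpha (i : V) : Var
  | tau (i : V) : Var
  | beta (e : Arc G r) : Var
  | Delta (e : Arc G r) : Var
  | eta (e : Arc G r) : Var
  | gamma (e : Arc G r) : Var
  | chi (e : Arc G r) : Var
  | x (i : V) (s : ℕ) (y : Bool) (t : ℕ) (hs : s ≤ deg G r i) (ht : t ≤ Fintype.card V) : Var

/-- The names of the constraints, with the ranges of their indices. -/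
inductive Con (k : ℤ) : Type u where
  | lamGe : Con k
  | vertexGe (i : V) : Con k
  | edgeGe (e : Arc G r) : Con k
  | lamZ : Con k
  | root0 (t : ℕ) (hk : k ≤ t) (ht : t ≤ Fintype.card V) : Con k
  | root1 (t : ℕ) (hk : k ≤ t) (ht : t ≤ Fintype.card V) : Con k
  | base0 (i : V) (s : ℕ) (hs : s ≤ deg G r i) : Con k
  | base1 (i : V) (s : ℕ) (hs : s ≤ deg G r i) : Con k
  | first00 (i : V) (hi : 1 ≤ deg G r i) (t : ℕ) (ht : t + 2 ≤ size G r i 1) : Con k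
  | first01 (i : V) (hi : 1 ≤ deg G r i) (t : ℕ) (h1 : 1 ≤ t) (ht : t + 1 ≤ size G r i 1) : Con k
  | first10 (i : V) (hi : 1 ≤ deg G r i) (t : ℕ) (h1 : 1 ≤ t) (ht : t + 1 ≤ size G r i 1) : Con k
  | first11 (i : V) (hi : 1 ≤ deg G r i) (t : ℕ) (h2 : 2 ≤ t) (ht : t ≤ size G r i 1) : Con k
  | next00 (i : V) (s : ℕ) (hs2 : 2 ≤ s) (hs : s ≤ deg G r i)
      (t : ℕ) (ht : t + 2 ≤ size G r i s)
      (a : ℕ) (hmin : t + 1 ≤ a + size G r i (s - 1))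
      (hmax : a + 1 ≤ fullSize G r (child G r i s (by omega) hs)) (hat : a ≤ t) : Con k
  | next01 (i : V) (s : ℕ) (hs2 : 2 ≤ s) (hs : s ≤ deg G r i)
      (t : ℕ) (h1 : 1 ≤ t) (ht : t + 1 ≤ size G r i s)
      (a : ℕ) (ha : 1 ≤ a) (hmin : t + 1 ≤ a + size G r i (s - 1))
      (hmax : a ≤ fullSize G r (child G r i s (by omega) hs)) (hat : a ≤ t) : Con k
  | next10 (i : V) (s : ℕ) (hs2 : 2 ≤ s) (hs : s ≤ deg G r i)
      (t : ℕ) (h1 : 1 ≤ t) (ht : t + 1 ≤ size G r i s)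
      (a : ℕ) (hmin : t ≤ a + size G r i (s - 1))
      (hmax : a + 1 ≤ fullSize G r (child G r i s (by omega) hs)) (hat : a + 1 ≤ t) : Con k
  | next11 (i : V) (s : ℕ) (hs2 : 2 ≤ s) (hs : s ≤ deg G r i)
      (t : ℕ) (h2 : 2 ≤ t) (ht : t ≤ size G r i s)
      (a : ℕ) (ha : 1 ≤ a) (hmin : t ≤ a + size G r i (s - 1))
      (hmax : a ≤ fullSize G r (child G r i s (by omega) hs)) (hat : a + 1 ≤ t) : Con k
  | etaNonneg (e : Arc G r) : Con k
  | gammaNonneg (e : Arc G r) : Con k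
  | DeltaNonneg (e : Arc G r) : Con k
  | tauNonneg (i : V) : Con k
  | chiNonneg (e : Arc G r) : Con k

variable {G r}

/-- The value of a variable, as a linear form. -/
def val (v : Var G r) : Form (Var G r) := LinearMap.proj v

/-- The variable `x_{i,s,y,t}`, as a linear form. -/
def X (i : V) (s : ℕ) (y : Bool) (t : ℕ) (hs : s ≤ deg G r i) (ht : t ≤ Fintype.card V) :
    Form (Var G r) :=
  val (Var.x i s y t hs ht)

/-- The variable `x_{j,d_j,y,t}`, as a linear form. -/
noncomputable def Xfull (j : V) (y : Bool) (t : ℕ) (ht : t ≤ Fintype.card V) :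
    Form (Var G r) :=
  X j (deg G r j) y t le_rfl ht

open Var in
/-- The constraints. -/
noncomputable def conOf (k : ℤ) : Con G r k → LinConstraint (Var G r)
  | .lamGe =>
      .ge (val lam - ∑ e : Arc G r, (val (Delta e) + val (chi e)) - ∑ i, val (tau i)) 0
  | .vertexGe i =>
      .ge (∑ e : Arc G r with e.tail = i, (val (Delta e) - val (eta e))
        + ∑ e : Arc G r with e.head = i, (val (Delta e) - val (gamma e))
        + val (tau i) + val (alpha i)) 0
  | .edgeGe e =>
      .ge (val (eta e) + val (gamma e) - val (Delta e) + val (chi e) + val (beta e)) 0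
  | .lamZ => .ge (val lam + val z) 1
  | .root0 t _ ht => .ge (Xfull r false t ht - val z) 0
  | .root1 t _ ht => .ge (Xfull r true t ht - val z) 0
  | .base0 i s hs => .eq (X i s false 0 hs (Nat.zero_le _)) 0
  | .base1 i s hs => .eq (X i s true 1 hs (one_le_card i) - val (alpha i)) 0
  | .first00 i hi t ht =>
      have hc := size_le G r i 1
      .ge (Xfull (child G r i 1 le_rfl hi) false t (by omega) - X i 1 false t hi (by omega)) 0
  | .first01 i hi t _ ht =>
      have hc := size_le G r i 1
      .ge (Xfull (child G r i 1 le_rfl hi) true t (by omega) - X i 1 false t hi (by omega)) 0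
  | .first10 i hi t _ ht =>
      have hc := size_le G r i 1
      .ge (Xfull (child G r i 1 le_rfl hi) false (t - 1) (by omega) - X i 1 true t hi (by omega)
        + val (alpha i)) 0
  | .first11 i hi t _ ht =>
      have hc := size_le G r i 1
      .ge (Xfull (child G r i 1 le_rfl hi) true (t - 1) (by omega) - X i 1 true t hi (by omega)
        + val (alpha i) + val (beta (arcTo G r i 1 le_rfl hi))) 0
  | .next00 i s _ hs t ht a _ _ _ =>
      have hc := size_le G r i s
      .ge (X i (s - 1) false (t - a) (by omega) (by omega)
        + Xfull (child G r i s (by omega) hs) false a (by omega)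
        - X i s false t hs (by omega)) 0
  | .next01 i s _ hs t _ ht a _ _ _ _ =>
      have hc := size_le G r i s
      .ge (X i (s - 1) false (t - a) (by omega) (by omega)
        + Xfull (child G r i s (by omega) hs) true a (by omega)
        - X i s false t hs (by omega)) 0
  | .next10 i s _ hs t _ ht a _ _ _ =>
      have hc := size_le G r i s
      .ge (X i (s - 1) true (t - a) (by omega) (by omega)
        + Xfull (child G r i s (by omega) hs) false a (by omega)
        - X i s true t hs (by omega)) 0
  | .next11 i s _ hs t _ ht a _ _ _ _ =>
      have hc := size_le G r i s
      .ge (X i (s - 1) true (t - a) (by omega) (by omega)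
        + Xfull (child G r i s (by omega) hs) true a (by omega)
        - X i s true t hs (by omega)
        + val (beta (arcTo G r i s (by omega) hs))) 0
  | .etaNonneg e => .ge (val (eta e)) 0
  | .gammaNonneg e => .ge (val (gamma e)) 0
  | .DeltaNonneg e => .ge (val (Delta e)) 0
  | .tauNonneg i => .ge (val (tau i)) 0
  | .chiNonneg e => .ge (val (chi e)) 0

variable (G r)

/-- The compact linear program of the tree `G` rooted at `r`. -/
noncomputable def compactLP (p : V → ℝ) (q : Sym2 V → ℝ) (k : ℤ) :
    LinProgram (Var G r) (Con G r k) where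
  objective := val Var.lam + ∑ i, p i • val (Var.alpha i)
    + ∑ e : Arc G r, q s(e.tail, e.head) • val (Var.beta e)
  constraint := conOf k

end Rooted

end TreeBound

/-!
The bound `U(k)` is the value of a linear program over distributions on `{0,1}^V`. Its dual asks
for a quadratic function `Q(c) = λ + ∑ α_i c_i + ∑ β_ij c_i c_j` on the tree, of least value
`λ + ∑ α_i p_i + ∑ β_ij p_ij`, with `Q(c) ≥ 0` for all `c` and `Q(c) ≥ 1` whenever `∑ c_i ≥ k`. The
compact program encodes these two families of exponentially many conditions.

* `Q ≥ 0` on `{0,1}^V`. On a tree this is equivalent to the existence of multipliers `Δ`, `η`, `γ`,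
  `χ`, `τ` (`HasCertificate`). Minimizing `Q` over the coordinate of a deepest vertex splits off a
  nonnegative function on one edge and leaves a nonnegative function with one edge less; a
  nonnegative function on one edge is a combination of `c_i c_j`, `c_i (1 - c_j)`, `(1 - c_i) c_j`
  and `(1 - c_i) (1 - c_j)`, and its four values are the multipliers (`hasCertificate_of_nonneg`).
  Conversely, a certificate gives `Q` a nonnegative value at all consistent marginals `(p, q)`, not
  only at `0-1` vectors (`HasCertificate.value_nonneg`).
* `Q ≥ 1` on `∑ c_i ≥ k`. The variables `x_{i,s,y,t}` stand for the least weight of the sub-tree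
  `T(i,s)` with `c_i = y` and `t` ones. By induction over the sub-trees they are lower bounds for the
  weights at every feasible point (`xval_le_weight`), and the least weights themselves are feasible,
  because optimal vectors on disjoint sub-trees can be glued (`minWeight_succ_le`).

Duality between the two exponential programs comes from Farkas' lemma (`exists_quad_or_masses`). The
set `Θ` is nonempty as a separating quadratic function would be nonnegative on `{0,1}^V` and
negative at `(p, q)`, against the first point. The maximum over the compact set `Θ` is attained, and
if no dual solution reached it, Farkas' lemma would provide a distribution with a larger value
(`exists_isGreatest_prob`).

For the size of the program, a pair `(i,s)` with `s ≥ 1` is determined by the child `i(s)`, so there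
are at most `2n` such pairs (`pairCode_inj`).
-/

namespace TreeBound

/-! ### Systems of linear inequalities -/

/-- **Farkas' lemma**: a linear functional that is nonnegative wherever finitely many given
functionals are is a nonnegative combination of them. The induction removes one functional at a
time by projecting onto its kernel. -/
theorem farkas {W ι : Type*} [AddCommGroup W] [Module ℝ W] (s : Finset ι) :
    ∀ (a : ι → W →ₗ[ℝ] ℝ) (b : W →ₗ[ℝ] ℝ),
      (∀ x, (∀ i ∈ s, 0 ≤ a i x) → 0 ≤ b x) →
      ∃ u : ι → ℝ, (∀ i, 0 ≤ u i) ∧ b = ∑ i ∈ s, u i • a i := by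
  classical
  induction s using Finset.induction_on with
  | empty =>
    intro a b h
    refine ⟨0, fun _ => le_rfl, ?_⟩
    ext x
    have h1 := h x (by simp)
    have h2 := h (-x) (by simp)
    rw [map_neg] at h2
    simp only [Finset.sum_empty, LinearMap.zero_apply]
    linarith
  | insert n s hn ih =>
    intro a b h
    by_cases hb : ∀ x, (∀ i ∈ s, 0 ≤ a i x) → 0 ≤ b x
    · obtain ⟨u, hu, hbu⟩ := ih a b hb
      refine ⟨fun i => if i = n then 0 else u i, fun i => ?_, ?_⟩
      · dsimp only
        split_ifs
        exacts [le_rfl, hu i]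
      · rw [Finset.sum_insert hn, hbu]
        simp only [if_true, zero_smul, zero_add]
        refine Finset.sum_congr rfl fun i hi => ?_
        rw [if_neg (ne_of_mem_of_not_mem hi hn)]
    · push Not at hb
      obtain ⟨y, hy, hby⟩ := hb
      have hny : a n y < 0 := by
        by_contra! hc
        exact absurd (h y ((Finset.forall_mem_insert ..).mpr ⟨hc, hy⟩)) (not_le.mpr hby)
      -- `z` is `y` rescaled so that `a n z = -1`; then `x + a n x • z` lies in the kernel of `a n`.
      set z := (-(a n y))⁻¹ • y with hz
      have hpos : 0 < (-(a n y))⁻¹ := inv_pos.mpr (by linarith)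
      have hnz : a n z = -1 := by
        rw [hz, map_smul, smul_eq_mul, inv_neg, neg_mul, inv_mul_cancel₀ hny.ne]
      have hbz : b z < 0 := by
        rw [hz, map_smul, smul_eq_mul]
        exact mul_neg_of_pos_of_neg hpos hby
      have haz : ∀ i ∈ s, 0 ≤ a i z := fun i hi => by
        rw [hz, map_smul, smul_eq_mul]
        exact mul_nonneg hpos.le (hy i hi)
      obtain ⟨u, hu, hbu⟩ := ih (fun i => a i + a i z • a n) (b + b z • a n) (by
        intro x hx
        have := h (x + a n x • z) (by
          intro i hi
          rcases Finset.mem_insert.mp hi with rfl | hi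
          · simp [hnz]
          · have := hx i hi
            simp only [LinearMap.add_apply, LinearMap.smul_apply, smul_eq_mul] at this
            simp only [map_add, map_smul, smul_eq_mul]
            linarith)
        simp only [map_add, map_smul, smul_eq_mul] at this
        simp only [LinearMap.add_apply, LinearMap.smul_apply, smul_eq_mul]
        linarith)
      have hc : 0 ≤ ∑ i ∈ s, u i * a i z - b z :=
        sub_nonneg.mpr (hbz.le.trans (Finset.sum_nonneg fun i hi => mul_nonneg (hu i) (haz i hi)))
      refine ⟨fun i => if i = n then ∑ i ∈ s, u i * a i z - b z else u i, fun i => ?_, ?_⟩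
      · dsimp only
        split_ifs
        exacts [hc, hu i]
      · rw [Finset.sum_insert hn]
        dsimp only
        rw [if_pos rfl]
        have e : ∑ i ∈ s, (if i = n then ∑ i ∈ s, u i * a i z - b z else u i) • a i
            = ∑ i ∈ s, u i • a i :=
          Finset.sum_congr rfl fun i hi => by
            rw [if_neg (ne_of_mem_of_not_mem hi hn)]
        rw [e]
        ext x
        have := LinearMap.congr_fun hbu x
        simp only [LinearMap.add_apply, LinearMap.smul_apply, smul_eq_mul, LinearMap.sum_apply,
          mul_add, Finset.sum_add_distrib, ← mul_assoc, ← Finset.sum_mul] at this ⊢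
        linarith

/-- A theorem of the alternative: either a finite system `b i ≤ a i x` of linear inequalities is
solvable, or some nonnegative combination of its rows reads `0 < 0`. -/
theorem solvable_or_certificate {W ι : Type*} [AddCommGroup W] [Module ℝ W] [Fintype ι]
    (a : ι → W →ₗ[ℝ] ℝ) (b : ι → ℝ) :
    (∃ x, ∀ i, b i ≤ a i x) ∨
      ∃ u : ι → ℝ, (∀ i, 0 ≤ u i) ∧ (∀ x, ∑ i, u i * a i x = 0) ∧ 0 < ∑ i, u i * b i := by
  by_cases hx : ∃ x, ∀ i, b i ≤ a i x
  · exact Or.inl hx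
  right
  -- Homogenize: the system `b i * t ≤ a i x` forces `t ≤ 0`.
  obtain ⟨u, hu, hsum⟩ := farkas (W := W × ℝ) Finset.univ
    (fun i => (a i).comp (LinearMap.fst ℝ W ℝ) - b i • LinearMap.snd ℝ W ℝ)
    (-LinearMap.snd ℝ W ℝ) (by
      rintro ⟨x, t⟩ h
      simp only [Finset.mem_univ, forall_true_left, LinearMap.sub_apply, LinearMap.comp_apply,
        LinearMap.fst_apply, LinearMap.smul_apply, LinearMap.snd_apply, smul_eq_mul] at h
      simp only [LinearMap.neg_apply, LinearMap.snd_apply, Left.nonneg_neg_iff]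
      by_contra! ht
      refine hx ⟨t⁻¹ • x, fun i => ?_⟩
      rw [map_smul, smul_eq_mul, inv_mul_eq_div, le_div_iff₀ ht]
      linarith [h i])
  have key : ∀ x t, -t = ∑ i, u i * (a i x - b i * t) := fun x t => by
    have := LinearMap.congr_fun hsum (x, t)
    simpa [LinearMap.sum_apply] using this
  refine ⟨u, hu, fun x => by simpa using (key x 0).symm, ?_⟩
  have h1 := key 0 1
  simp only [map_zero, mul_one, zero_sub, mul_neg, Finset.sum_neg_distrib] at h1
  linarith

/-! ### Rooted trees -/

section Tree

variable {V : Type u} {G : SimpleGraph V} {r : V}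

theorem IsChild.parent_unique (hG : G.IsTree) {u u' v : V} (h : IsChild G r u v)
    (h' : IsChild G r u' v) : u = u' := by
  obtain ⟨p, hp⟩ := hG.connected.exists_walk_length_eq_dist r u
  obtain ⟨p', hp'⟩ := hG.connected.exists_walk_length_eq_dist r u'
  have q : (p.concat h.1).IsPath := SimpleGraph.Walk.isPath_of_length_eq_dist _ (by
    rw [SimpleGraph.Walk.length_concat, hp, h.2])
  have q' : (p'.concat h'.1).IsPath := SimpleGraph.Walk.isPath_of_length_eq_dist _ (by
    rw [SimpleGraph.Walk.length_concat, hp', h'.2])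
  have e := (hG.existsUnique_path r v).unique q q'
  have := congrArg SimpleGraph.Walk.penultimate e
  simpa using this

/-- An arc is determined by its head. -/
theorem arc_ext (hG : G.IsTree) {e e' : Arc G r} (h : e.head = e'.head) : e = e' := by
  have h1 : IsChild G r e.tail e.head := e.2
  have h2 : IsChild G r e'.tail e'.head := e'.2
  rw [h] at h1
  exact Subtype.ext (Prod.ext (h1.parent_unique hG h2) h)

theorem isChild_or_isChild (hG : G.IsTree) {i j : V} (h : G.Adj i j) :
    IsChild G r i j ∨ IsChild G r j i :=
  (hG.dist_eq_dist_add_one_of_adj r h).elim (fun e => Or.inr ⟨h.symm, e⟩) fun e => Or.inl ⟨h, e⟩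

theorem exists_parent (hG : G.IsTree) {v : V} (hv : v ≠ r) : ∃ u, IsChild G r u v := by
  obtain ⟨p, hp⟩ := hG.connected.exists_walk_length_eq_dist v r
  cases p with
  | nil => exact absurd rfl hv
  | @cons _ u _ h p =>
    refine ⟨u, (isChild_or_isChild hG h.symm).resolve_right fun hc => ?_⟩
    have h1 := SimpleGraph.dist_le p
    have h2 := hc.2
    rw [SimpleGraph.Walk.length_cons, SimpleGraph.dist_comm] at hp
    rw [SimpleGraph.dist_comm] at h1
    omega

/-- `v` is `i` or a descendant of `i`. -/
abbrev Desc (G : SimpleGraph V) (r i v : V) : Prop := Relation.ReflTransGen (IsChild G r) i v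

theorem Desc.dist_le {i v : V} (h : Desc G r i v) : G.dist r i ≤ G.dist r v := by
  induction h with
  | refl => exact le_rfl
  | tail _ h ih => exact ih.trans (by rw [h.2]; omega)

theorem Desc.eq_of_dist_le {i v : V} (h : Desc G r i v) (hd : G.dist r v ≤ G.dist r i) :
    i = v := by
  rcases Relation.ReflTransGen.cases_tail h with h | ⟨w, hw, hwv⟩
  · exact h.symm
  · have := Desc.dist_le hw
    have := hwv.2
    omega

/-- The ancestors of a vertex form a chain. -/
theorem Desc.of_common (hG : G.IsTree) {a b v : V} (ha : Desc G r a v) (hb : Desc G r b v)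
    (hab : G.dist r a ≤ G.dist r b) : Desc G r a b := by
  induction ha with
  | refl => rw [hb.eq_of_dist_le hab]
  | tail hw hwv ih =>
    rcases Relation.ReflTransGen.cases_tail hb with h | ⟨w', hw', hwv'⟩
    · rw [← h]
      exact hw.tail hwv
    · rw [hwv.parent_unique hG hwv'] at ih
      exact ih hw'

theorem desc_root (hG : G.IsTree) (v : V) : Desc G r r v := by
  induction hn : G.dist r v generalizing v with
  | zero => rw [(hG.connected r v).dist_eq_zero_iff.mp hn]
  | succ n ih =>
    obtain ⟨u, hu⟩ := exists_parent (r := r) hG (v := v) (by rintro rfl; simp at hn)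
    exact (ih u (by have := hu.2; omega)).tail hu

variable [Fintype V] [LinearOrder V]

theorem mem_children {i j : V} : j ∈ children G r i ↔ IsChild G r i j := by
  classical
  simp [children]

theorem nodup_children (i : V) : (children G r i).Nodup := Finset.sort_nodup _ _

variable (G r) in
open Classical in
/-- The vertex set of `T(i,s)`, as a `Finset`. -/
noncomputable def verts (i : V) (s : ℕ) : Finset V := Finset.univ.filter (· ∈ subtree G r i s)

theorem mem_verts {i v : V} {s : ℕ} : v ∈ verts G r i s ↔ v ∈ subtree G r i s := by
  simp [verts]

theorem card_verts (i : V) (s : ℕ) : (verts G r i s).card = size G r i s := by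
  rw [size, ← Set.ncard_coe_finset]
  congr 1
  ext v
  simp [mem_verts]

theorem self_mem_verts (i : V) (s : ℕ) : i ∈ verts G r i s := mem_verts.mpr (Or.inl rfl)

theorem verts_zero (i : V) : verts G r i 0 = {i} := by
  ext v
  simp [mem_verts, subtree]

theorem size_zero (i : V) : size G r i 0 = 1 := by
  rw [← card_verts, verts_zero, Finset.card_singleton]

theorem mem_verts_deg {i v : V} : v ∈ verts G r i (deg G r i) ↔ Desc G r i v := by
  rw [mem_verts, subtree, deg, List.take_length]
  constructor
  · rintro (rfl | ⟨c, hc, h⟩)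
    · exact .refl
    · exact .head (mem_children.mp hc) h
  · intro h
    rcases Relation.ReflTransGen.cases_head h with h | ⟨c, hc, h⟩
    · exact Or.inl h.symm
    · exact Or.inr ⟨c, mem_children.mpr hc, h⟩

theorem verts_root (hG : G.IsTree) : verts G r r (deg G r r) = Finset.univ :=
  Finset.eq_univ_of_forall fun v => mem_verts_deg.mpr (desc_root hG v)

theorem verts_succ (i : V) (s : ℕ) (h : s + 1 ≤ deg G r i) :
    verts G r i (s + 1) = verts G r i s ∪
      verts G r (child G r i (s + 1) (by omega) h)
        (deg G r (child G r i (s + 1) (by omega) h)) := by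
  ext v
  rw [Finset.mem_union, mem_verts_deg, mem_verts, mem_verts, subtree, subtree,
    List.take_succ_eq_append_getElem (by unfold deg at h; omega)]
  simp only [Set.mem_ofPred_eq, List.mem_append, List.mem_singleton, or_and_right, exists_or,
    exists_eq_left, or_assoc]
  rfl

theorem disjoint_verts (hG : G.IsTree) (i : V) (s : ℕ) (h : s + 1 ≤ deg G r i) :
    Disjoint (verts G r i s) (verts G r (child G r i (s + 1) (by omega) h)
      (deg G r (child G r i (s + 1) (by omega) h))) := by
  rw [Finset.disjoint_left]
  intro v hv hj
  rw [mem_verts_deg] at hj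
  have hc := isChild_child G r i (s + 1) (by omega) h
  rw [mem_verts] at hv
  rcases hv with rfl | ⟨c, hcs, hcv⟩
  · have := hj.dist_le
    have := hc.2
    omega
  · have hci := mem_children.mp (List.mem_of_mem_take hcs)
    have e := (Desc.of_common hG hcv hj (by rw [hci.2, hc.2])).eq_of_dist_le (by rw [hci.2, hc.2])
    obtain ⟨m, hm, hme⟩ := List.mem_take_iff_getElem.mp hcs
    rw [e] at hme
    have := (nodup_children (G := G) (r := r) i).getElem_inj_iff.mp hme
    simp at this
    omega

/-- Apart from its top vertex, `T(i,s)` contains the parent of each of its vertices. -/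
theorem parent_mem_verts (hG : G.IsTree) {i u v : V} {s : ℕ} (hv : v ∈ verts G r i s) (hvi : v ≠ i)
    (huv : IsChild G r u v) : u ∈ verts G r i s := by
  rw [mem_verts] at hv ⊢
  obtain ⟨c, hcs, hcv⟩ := hv.resolve_left hvi
  rcases Relation.ReflTransGen.cases_tail hcv with h | ⟨w, hw, hwv⟩
  · subst h
    exact Or.inl (huv.parent_unique hG (mem_children.mp (List.mem_of_mem_take hcs)))
  · rw [huv.parent_unique hG hwv]
    exact Or.inr ⟨c, hcs, hw⟩

theorem size_succ (hG : G.IsTree) (i : V) (s : ℕ) (h : s + 1 ≤ deg G r i) :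
    size G r i (s + 1) = size G r i s + fullSize G r (child G r i (s + 1) (by omega) h) := by
  rw [fullSize, ← card_verts, ← card_verts, ← card_verts, verts_succ i s h,
    Finset.card_union_of_disjoint (disjoint_verts hG i s h)]

/-- Induction along the decomposition of `T(i,s+1)` into `T(i,s)` and the full sub-tree of the next
child. -/
theorem subtree_induction (hG : G.IsTree) {P : V → ℕ → Prop} (zero : ∀ i, P i 0)
    (succ : ∀ i s (h : s + 1 ≤ deg G r i), P i s →
      P (child G r i (s + 1) (by omega) h) (deg G r (child G r i (s + 1) (by omega) h)) →
      P i (s + 1)) (i : V) (s : ℕ) (hs : s ≤ deg G r i) : P i s := by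
  induction hn : size G r i s using Nat.strong_induction_on generalizing i s with
  | _ n ih =>
    cases s with
    | zero => exact zero i
    | succ s =>
      have e := size_succ hG i s hs
      have h1 : 0 < size G r i s := by
        rw [← card_verts]
        exact Finset.card_pos.mpr ⟨i, self_mem_verts i s⟩
      have h2 : 0 < fullSize G r (child G r i (s + 1) (by omega) hs) := by
        rw [fullSize, ← card_verts]
        exact Finset.card_pos.mpr ⟨_, self_mem_verts _ _⟩
      exact succ i s hs (ih _ (by omega) i s (by omega) rfl)
        (ih _ (by unfold fullSize at e h2; omega) _ _ le_rfl rfl)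

end Tree

/-! ### Nonnegative quadratic functions on a tree -/

section Certificate

variable {V : Type u} [Fintype V] [LinearOrder V] {G : SimpleGraph V} {r : V}

/-- The real number `0` or `1` that a Boolean stands for. -/
def bit (b : Bool) : ℝ := (b.toNat : ℝ)

@[simp] theorem bit_true : bit true = 1 := by simp [bit]

@[simp] theorem bit_false : bit false = 0 := by simp [bit]

/-- The value of `lam + ∑ α_i p_i + ∑ β_ij q_ij`. -/
noncomputable def value (lam : ℝ) (α : V → ℝ) (β : Arc G r → ℝ) (p : V → ℝ) (q : Arc G r → ℝ) : ℝ :=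
  lam + ∑ i, α i * p i + ∑ e, β e * q e

/-- The value of the quadratic function `lam + ∑ α_i c_i + ∑ β_ij c_i c_j` at a `0-1` vector. -/
noncomputable def quad (lam : ℝ) (α : V → ℝ) (β : Arc G r → ℝ) (c : V → Bool) : ℝ :=
  value lam α β (fun i => bit (c i)) (fun e => bit (c e.tail) * bit (c e.head))

/-- The constraints of the compact linear program without the variables `z` and `x` can be satisfied
with the given `λ`, `α`, `β`. -/
def HasCertificate (lam : ℝ) (α : V → ℝ) (β : Arc G r → ℝ) : Prop :=
  ∃ (τ : V → ℝ) (Δ η γ χ : Arc G r → ℝ),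
    (∀ i, 0 ≤ τ i) ∧ (∀ e, 0 ≤ Δ e) ∧ (∀ e, 0 ≤ η e) ∧ (∀ e, 0 ≤ γ e) ∧ (∀ e, 0 ≤ χ e) ∧
    0 ≤ lam - ∑ e, (Δ e + χ e) - ∑ i, τ i ∧
    (∀ i, 0 ≤ ∑ e with e.tail = i, (Δ e - η e) + ∑ e with e.head = i, (Δ e - γ e) + τ i + α i) ∧
    ∀ e, 0 ≤ η e + γ e - Δ e + χ e + β e

theorem HasCertificate.add {l l' : ℝ} {α α' : V → ℝ} {β β' : Arc G r → ℝ}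
    (h : HasCertificate l α β) (h' : HasCertificate l' α' β') :
    HasCertificate (l + l') (fun i => α i + α' i) (fun e => β e + β' e) := by
  obtain ⟨τ, Δ, η, γ, χ, h1, h2, h3, h4, h5, hl, hv, he⟩ := h
  obtain ⟨τ', Δ', η', γ', χ', h1', h2', h3', h4', h5', hl', hv', he'⟩ := h'
  refine ⟨fun i => τ i + τ' i, fun e => Δ e + Δ' e, fun e => η e + η' e, fun e => γ e + γ' e,
    fun e => χ e + χ' e, fun i => add_nonneg (h1 i) (h1' i), fun i => add_nonneg (h2 i) (h2' i),
    fun i => add_nonneg (h3 i) (h3' i), fun i => add_nonneg (h4 i) (h4' i),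
    fun i => add_nonneg (h5 i) (h5' i), ?_, fun i => ?_, fun e => ?_⟩
  · simp only [Finset.sum_add_distrib] at hl hl' ⊢
    linarith
  · have := hv i
    have := hv' i
    simp only [Finset.sum_add_distrib, Finset.sum_sub_distrib] at *
    linarith
  · linarith [he e, he' e]

/-- A function `l + a y_i + b y_j + d y_i y_j` on one edge that is nonnegative at the four `0-1`
points has a certificate: it is the combination of `(1 - y_i)(1 - y_j)`, `y_i (1 - y_j)`,
`(1 - y_i) y_j` and `y_i y_j` with its four values as coefficients. -/
theorem hasCertificate_edge (e₀ : Arc G r) {l a b d : ℝ} (h00 : 0 ≤ l) (h10 : 0 ≤ l + a)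
    (h01 : 0 ≤ l + b) (h11 : 0 ≤ l + a + b + d) :
    HasCertificate l
      (fun i => (if e₀.tail = i then a else 0) + if e₀.head = i then b else 0)
      (fun e => by classical exact if e = e₀ then d else 0) := by
  classical
  refine ⟨0, fun e => if e = e₀ then l else 0, fun e => if e = e₀ then l + a else 0,
    fun e => if e = e₀ then l + b else 0, 0, fun _ => le_rfl, fun e => ?_, fun e => ?_, fun e => ?_,
    fun _ => le_rfl, ?_, fun i => ?_, fun e => ?_⟩
  · dsimp only; split_ifs <;> simp_all
  · dsimp only; split_ifs <;> simp_all
  · dsimp only; split_ifs <;> simp_all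
  · simp
  · have h (x y : ℝ) (e : Arc G r) :
        (if e = e₀ then x else 0) - (if e = e₀ then y else 0) = if e = e₀ then x - y else 0 := by
      split_ifs <;> simp
    simp only [h, Finset.sum_ite_eq', Finset.mem_filter, Finset.mem_univ, true_and]
    simp only [Pi.zero_apply]
    split_ifs <;> linarith
  · dsimp only
    simp only [Pi.zero_apply]
    split_ifs <;> linarith

theorem hasCertificate_of_forall_beta_eq_zero {lam : ℝ} {α : V → ℝ} {β : Arc G r → ℝ}
    (hβ : ∀ e, β e = 0) (h : ∀ c, 0 ≤ quad lam α β c) : HasCertificate lam α β := by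
  refine ⟨fun i => max 0 (-α i), fun _ => 0, fun _ => 0, fun _ => 0, fun _ => 0,
    fun i => le_max_left _ _, fun _ => le_rfl,
    fun _ => le_rfl, fun _ => le_rfl, fun _ => le_rfl, ?_, fun i => ?_, fun e => ?_⟩
  · -- the minimum is attained where `c_i = 1` exactly if `α_i < 0`
    have := h fun i => decide (α i < 0)
    simp only [quad, value, hβ, zero_mul, Finset.sum_const_zero, add_zero] at this
    simp only [add_zero, Finset.sum_const_zero, sub_zero]
    have e : ∑ i, α i * bit (decide (α i < 0)) = -∑ i, max 0 (-α i) := by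
      rw [← Finset.sum_neg_distrib]
      refine Finset.sum_congr rfl fun i _ => ?_
      by_cases hi : α i < 0
      · simp [hi, hi.le]
      · simp [hi, not_lt.mp hi]
    linarith
  · simp only [sub_zero, Finset.sum_const_zero, zero_add]
    linarith [le_max_right 0 (-α i)]
  · simp [hβ e]

/-- A quadratic function supported on the edges of a tree that is nonnegative on `{0,1}^V` has a
certificate. A deepest edge `(u,v)` is split off: minimizing over `c_v` leaves a function
`A + B c_u` of the other end, the difference lives on the edge and is nonnegative, and the function
with one edge less is nonnegative as well. -/
theorem hasCertificate_of_nonneg (hG : G.IsTree) {lam : ℝ} {α : V → ℝ} {β : Arc G r → ℝ}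
    (h : ∀ c, 0 ≤ quad lam α β c) : HasCertificate lam α β := by
  classical
  suffices H : ∀ (F : Finset (Arc G r)) (lam : ℝ) (α : V → ℝ) (β : Arc G r → ℝ),
      (∀ e, e ∉ F → β e = 0) → (∀ c, 0 ≤ quad lam α β c) → HasCertificate lam α β from
    H Finset.univ lam α β (fun e he => absurd (Finset.mem_univ e) he) h
  intro F
  induction hn : F.card generalizing F with
  | zero =>
    intro lam α β hβ h
    rw [Finset.card_eq_zero] at hn
    exact hasCertificate_of_forall_beta_eq_zero (fun e => hβ e (by simp [hn])) h
  | succ n ih =>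
    intro lam α β hβ h
    obtain ⟨e₀, he₀, hmax⟩ := Finset.exists_max_image F (fun e => G.dist r e.head)
      (Finset.card_pos.mp (by omega))
    have htail : ∀ e ∈ F, e.tail ≠ e₀.head := fun e he hc => by
      have h1 := hmax e he
      have h2 : G.dist r e.head = G.dist r e.tail + 1 := e.2.2
      rw [hc] at h2
      omega
    have hhead : ∀ e : Arc G r, e.head = e₀.head → e = e₀ := fun _ => arc_ext hG
    have huv : e₀.tail ≠ e₀.head := e₀.2.1.ne
    set A := min 0 (α e₀.head) with hA
    set B := min 0 (α e₀.head + β e₀) - A with hB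
    have hcert := ih (F.erase e₀) (by rw [Finset.card_erase_of_mem he₀]; omega) (lam + A)
      (fun i => α i - ((if e₀.tail = i then -B else 0) + if e₀.head = i then α e₀.head else 0))
      (fun e => β e - if e = e₀ then β e₀ else 0)
      (fun e he => by
        by_cases hc : e = e₀
        · simp [hc]
        · simp [hc, hβ e fun hF => he (Finset.mem_erase.mpr ⟨hc, hF⟩)])
      (fun c => by
        -- the best choice for the coordinate of the deepest vertex
        set b : Bool := decide (α e₀.head + β e₀ * bit (c e₀.tail) < 0) with hb
        have := h (Function.update c e₀.head b)
        have e1 : ∑ i, α i * bit (Function.update c e₀.head b i)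
            = ∑ i, α i * bit (c i) - α e₀.head * bit (c e₀.head) + α e₀.head * bit b := by
          have (i : V) : α i * bit (Function.update c e₀.head b i) = α i * bit (c i)
              + if e₀.head = i then α e₀.head * bit b - α e₀.head * bit (c e₀.head) else 0 := by
            by_cases hi : e₀.head = i
            · subst hi
              simp
            · rw [Function.update_of_ne (Ne.symm hi), if_neg hi, add_zero]
          simp only [this, Finset.sum_add_distrib, Finset.sum_ite_eq, Finset.mem_univ, if_true]
          ring
        have e2 : ∑ e : Arc G r, β e * (bit (Function.update c e₀.head b e.tail)
              * bit (Function.update c e₀.head b e.head))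
            = ∑ e : Arc G r, (β e - if e = e₀ then β e₀ else 0) * (bit (c e.tail) * bit (c e.head))
              + β e₀ * bit (c e₀.tail) * bit b := by
          have (e : Arc G r) : β e * (bit (Function.update c e₀.head b e.tail)
              * bit (Function.update c e₀.head b e.head))
              = (β e - if e = e₀ then β e₀ else 0) * (bit (c e.tail) * bit (c e.head))
                + if e = e₀ then β e₀ * bit (c e₀.tail) * bit b else 0 := by
            by_cases he : e = e₀
            · subst he
              rw [Function.update_of_ne huv]
              simp [mul_assoc]
            · by_cases hF : e ∈ F
              · rw [Function.update_of_ne (htail e hF),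
                  Function.update_of_ne fun hc => he (hhead e hc)]
                simp [he]
              · simp [he, hβ e hF]
          simp only [this, Finset.sum_add_distrib, Finset.sum_ite_eq', Finset.mem_univ, if_true]
        have e3 : ∑ i, (α i - ((if e₀.tail = i then -B else 0)
              + if e₀.head = i then α e₀.head else 0)) * bit (c i)
            = ∑ i, α i * bit (c i) + B * bit (c e₀.tail) - α e₀.head * bit (c e₀.head) := by
          simp only [sub_mul, add_mul, ite_mul, zero_mul, Finset.sum_sub_distrib,
            Finset.sum_add_distrib, Finset.sum_ite_eq, Finset.mem_univ, if_true]
          ring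
        have e4 : α e₀.head * bit b + β e₀ * bit (c e₀.tail) * bit b = A + B * bit (c e₀.tail) := by
          rw [hB, hb]
          rcases c e₀.tail with _ | _
          · by_cases h0 : α e₀.head < 0
            · simp [h0, hA, h0.le]
            · simp [h0, hA, not_lt.mp h0]
          · by_cases h0 : α e₀.head + β e₀ < 0
            · simp [h0, h0.le]
            · simp [h0, not_lt.mp h0]
        simp only [quad, value] at this ⊢
        rw [e1, e2] at this
        rw [e3]
        linarith)
    have hedge := hasCertificate_edge e₀ (l := -A) (a := -B) (b := α e₀.head) (d := β e₀)
      (by linarith [min_le_left 0 (α e₀.head)])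
      (by linarith [min_le_left 0 (α e₀.head + β e₀)])
      (by linarith [min_le_right 0 (α e₀.head)])
      (by linarith [min_le_right 0 (α e₀.head + β e₀)])
    simpa using hcert.add hedge

/-- The converse, for fractional points as well: a certificate is a combination of the inequalities
`max 0 (p_i + p_j - 1) ≤ q_ij ≤ min p_i p_j` and `p_i, q_ij ≤ 1`. -/
theorem HasCertificate.value_nonneg {lam : ℝ} {α : V → ℝ} {β : Arc G r → ℝ}
    (h : HasCertificate lam α β) {p : V → ℝ} {q : Arc G r → ℝ} (hp : ∀ i, 0 ≤ p i ∧ p i ≤ 1)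
    (hq : ∀ e : Arc G r, 0 ≤ q e ∧ 0 ≤ p e.tail - q e ∧ 0 ≤ p e.head - q e ∧
      0 ≤ 1 - p e.tail - p e.head + q e) : 0 ≤ value lam α β p q := by
  obtain ⟨τ, Δ, η, γ, χ, hτ, hΔ, hη, hγ, hχ, hl, hv, he⟩ := h
  have swap (f : Arc G r → ℝ) (m : Arc G r → V) :
      ∑ i, p i * ∑ e with m e = i, f e = ∑ e, p (m e) * f e := by
    simp only [Finset.mul_sum, Finset.sum_filter, mul_ite, mul_zero]
    rw [Finset.sum_comm]
    simp
  have s1 : 0 ≤ ∑ i, p i * (∑ e with e.tail = i, (Δ e - η e) + ∑ e with e.head = i, (Δ e - γ e)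
      + τ i + α i) := Finset.sum_nonneg fun i _ => mul_nonneg (hp i).1 (hv i)
  have s2 : 0 ≤ ∑ e : Arc G r, (q e * (η e + γ e - Δ e + χ e + β e)
      + Δ e * (1 - p e.tail - p e.head + q e) + η e * (p e.tail - q e) + γ e * (p e.head - q e)
      + χ e * (1 - q e)) := Finset.sum_nonneg fun e _ => by
    obtain ⟨h1, h2, h3, h4⟩ := hq e
    have h5 : 0 ≤ 1 - q e := by linarith [(hp e.tail).2]
    have := mul_nonneg h1 (he e)
    have := mul_nonneg (hΔ e) h4
    have := mul_nonneg (hη e) h2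
    have := mul_nonneg (hγ e) h3
    have := mul_nonneg (hχ e) h5
    linarith
  have s3 : 0 ≤ ∑ i, τ i * (1 - p i) :=
    Finset.sum_nonneg fun i _ => mul_nonneg (hτ i) (by linarith [(hp i).2])
  have e1 : ∑ i, p i * (∑ e with e.tail = i, (Δ e - η e) + ∑ e with e.head = i, (Δ e - γ e)
      + τ i + α i) = ∑ e : Arc G r, (p e.tail * (Δ e - η e) + p e.head * (Δ e - γ e))
      + ∑ i, (p i * τ i + α i * p i) := by
    simp only [mul_add, Finset.sum_add_distrib, swap, mul_comm (α _)]
    ring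
  rw [e1] at s1
  have e2 : value lam α β p q = (lam - ∑ e, (Δ e + χ e) - ∑ i, τ i)
      + (∑ e : Arc G r, (p e.tail * (Δ e - η e) + p e.head * (Δ e - γ e))
        + ∑ i, (p i * τ i + α i * p i))
      + ∑ e : Arc G r, (q e * (η e + γ e - Δ e + χ e + β e)
        + Δ e * (1 - p e.tail - p e.head + q e) + η e * (p e.tail - q e) + γ e * (p e.head - q e)
        + χ e * (1 - q e)) + ∑ i, τ i * (1 - p i) := by
    have e3 : ∑ i, τ i = ∑ i, (p i * τ i + α i * p i) + ∑ i, τ i * (1 - p i)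
        - ∑ i, α i * p i := by
      rw [← Finset.sum_add_distrib, ← Finset.sum_sub_distrib]
      exact Finset.sum_congr rfl fun i _ => by ring
    have e4 : ∑ e : Arc G r, (p e.tail * (Δ e - η e) + p e.head * (Δ e - γ e))
      + ∑ e : Arc G r, (q e * (η e + γ e - Δ e + χ e + β e)
        + Δ e * (1 - p e.tail - p e.head + q e) + η e * (p e.tail - q e) + γ e * (p e.head - q e)
        + χ e * (1 - q e)) = ∑ e, (Δ e + χ e) + ∑ e, β e * q e := by
      rw [← Finset.sum_add_distrib, ← Finset.sum_add_distrib]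
      exact Finset.sum_congr rfl fun i _ => by ring
    unfold value
    linarith
  linarith

theorem HasCertificate.quad_nonneg {lam : ℝ} {α : V → ℝ} {β : Arc G r → ℝ}
    (h : HasCertificate lam α β) (c : V → Bool) : 0 ≤ quad lam α β c := by
  refine h.value_nonneg (fun i => ?_) fun e => ?_
  · cases c i <;> simp
  · cases c e.tail <;> cases c e.head <;> simp

end Certificate

/-! ### Duality for distributions with given marginals -/

section Duality

variable {V : Type u} {G : SimpleGraph V} {r : V}

theorem indicator_coordinate (i : V) (c : V → Bool) :
    ({c | c i = true} : Set (V → Bool)).indicator (1 : (V → Bool) → ℝ) c = bit (c i) := by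
  classical
  by_cases h : c i = true <;> simp [h]

theorem indicator_coordinate_pair (i j : V) (c : V → Bool) :
    ({c | c i = true ∧ c j = true} : Set (V → Bool)).indicator (1 : (V → Bool) → ℝ) c
      = bit (c i) * bit (c j) := by
  classical
  by_cases h : c i = true <;> by_cases h' : c j = true <;> simp [h, h']

variable [Fintype V] [LinearOrder V]

theorem prob_eq_sum (θ : (V → Bool) → ℝ) (A : Set (V → Bool)) :
    prob θ A = ∑ c, θ c * A.indicator 1 c := by
  classical
  refine Finset.sum_congr rfl fun c _ => ?_
  by_cases h : c ∈ A <;> simp [h]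

theorem continuous_prob (A : Set (V → Bool)) : Continuous fun θ => prob θ A := by
  simp only [prob_eq_sum]
  fun_prop

variable (r) in
/-- The bivariate probabilities, as a function of the arcs. -/
def arcProb (G : SimpleGraph V) (q : Sym2 V → ℝ) (e : Arc G r) : ℝ := q s(e.tail, e.head)

theorem sum_mul_quad_of_mem_Theta {p : V → ℝ} {q : Sym2 V → ℝ} {θ : (V → Bool) → ℝ}
    (hθ : θ ∈ Theta G p q) (lam : ℝ) (α : V → ℝ) (β : Arc G r → ℝ) :
    ∑ c, θ c * quad lam α β c = value lam α β p (arcProb r G q) := by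
  obtain ⟨⟨-, h1⟩, hp, hq⟩ := hθ
  have hp' (i : V) : ∑ c, θ c * bit (c i) = p i := by
    rw [← hp i, prob_eq_sum]
    simp only [indicator_coordinate]
  have hq' (e : Arc G r) : ∑ c, θ c * (bit (c e.tail) * bit (c e.head)) = arcProb r G q e := by
    rw [arcProb, ← hq e.tail e.head e.2.1, prob_eq_sum]
    simp only [indicator_coordinate_pair]
  simp only [quad, value, mul_add, Finset.sum_add_distrib, Finset.mul_sum]
  rw [← Finset.sum_mul, h1, one_mul, Finset.sum_comm,
    Finset.sum_comm (s := Finset.univ (α := V → Bool))]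
  congr 1
  · congr 1
    refine Finset.sum_congr rfl fun i _ => ?_
    rw [← hp' i, Finset.mul_sum]
    exact Finset.sum_congr rfl fun c _ => by ring
  · refine Finset.sum_congr rfl fun e _ => ?_
    rw [← hq' e, Finset.mul_sum]
    exact Finset.sum_congr rfl fun c _ => by ring

theorem prob_le_value {p : V → ℝ} {q : Sym2 V → ℝ} {θ : (V → Bool) → ℝ}
    (hθ : θ ∈ Theta G p q) {A : Set (V → Bool)} {lam : ℝ} {α : V → ℝ} {β : Arc G r → ℝ}
    (h : ∀ c, A.indicator 1 c ≤ quad lam α β c) :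
    prob θ A ≤ value lam α β p (arcProb r G q) := by
  rw [← sum_mul_quad_of_mem_Theta hθ, prob_eq_sum]
  exact Finset.sum_le_sum fun c _ => mul_le_mul_of_nonneg_left (h c) (hθ.1.1 c)

/-- Point masses that integrate every quadratic function of the tree to `m` times its value at the
given marginals become, divided by `m`, a distribution with these marginals. -/
theorem div_mem_Theta (hG : G.IsTree) {p : V → ℝ} {q : Sym2 V → ℝ} {u : (V → Bool) → ℝ} {m : ℝ}
    (hu : ∀ c, 0 ≤ u c) (hm : 0 < m)
    (h : ∀ lam α β, ∑ c, u c * quad lam α β c = m * value lam α β p (arcProb r G q)) :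
    (fun c => u c / m) ∈ Theta G p q := by
  classical
  have hpair (e : Arc G r) :
      prob (fun c => u c / m) {c | c e.tail = true ∧ c e.head = true} = q s(e.tail, e.head) := by
    have := h 0 0 (Pi.single e 1)
    simp only [quad, value, Pi.single_apply, ite_mul, one_mul, zero_mul, Pi.zero_apply,
      Finset.sum_const_zero, Finset.sum_ite_eq', Finset.mem_univ, if_true, zero_add] at this
    simp only [prob_eq_sum, indicator_coordinate_pair, div_mul_eq_mul_div]
    rw [← Finset.sum_div, this, mul_div_cancel_left₀ _ hm.ne']
    rfl
  refine ⟨⟨fun c => div_nonneg (hu c) hm.le, ?_⟩, fun i => ?_, fun i j hij => ?_⟩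
  · have := h 1 0 0
    simp only [quad, value, Pi.zero_apply, zero_mul, Finset.sum_const_zero, add_zero,
      mul_one] at this
    rw [← Finset.sum_div, this, div_self hm.ne']
  · have := h 0 (Pi.single i 1) 0
    simp only [quad, value, Pi.single_apply, ite_mul, one_mul, zero_mul, Pi.zero_apply,
      Finset.sum_const_zero, Finset.sum_ite_eq', Finset.mem_univ, if_true, zero_add,
      add_zero] at this
    simp only [prob_eq_sum, indicator_coordinate, div_mul_eq_mul_div]
    rw [← Finset.sum_div, this, mul_div_cancel_left₀ _ hm.ne']
  · rcases isChild_or_isChild (r := r) hG hij with hc | hc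
    · exact hpair ⟨(i, j), hc⟩
    · rw [Sym2.eq_swap]
      rw [show {c : V → Bool | c i = true ∧ c j = true} = {c | c j = true ∧ c i = true} from
        Set.ext fun c => and_comm]
      exact hpair ⟨(j, i), hc⟩

/-- The alternative for the dual program of the moment problem: either some quadratic function of
the tree majorizes `f` and has value at most `t` at `(p,q)`, or there are point masses that show
this to be impossible. -/
theorem exists_quad_or_masses (p : V → ℝ) (q : Arc G r → ℝ) (f : (V → Bool) → ℝ) (t : ℝ) :
    (∃ lam α β, (∀ c, f c ≤ quad lam α β c) ∧ value lam α β p q ≤ t) ∨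
    ∃ (u : (V → Bool) → ℝ) (m : ℝ), (∀ c, 0 ≤ u c) ∧ 0 ≤ m ∧
      (∀ lam α β, ∑ c, u c * quad lam α β c = m * value lam α β p q) ∧
      m * t < ∑ c, u c * f c := by
  let L (p : V → ℝ) (q : Arc G r → ℝ) : (ℝ × (V → ℝ) × (Arc G r → ℝ)) →ₗ[ℝ] ℝ :=
    { toFun := fun w => value w.1 w.2.1 w.2.2 p q
      map_add' := fun x y => by
        simp only [value, Prod.fst_add, Prod.snd_add, Pi.add_apply, add_mul,
          Finset.sum_add_distrib]
        ring
      map_smul' := fun a x => by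
        simp only [value, Prod.smul_fst, Prod.smul_snd, Pi.smul_apply, smul_eq_mul, mul_assoc,
          mul_add, Finset.mul_sum, RingHom.id_apply] }
  have hL p q lam α β : L p q (lam, α, β) = value lam α β p q := rfl
  rcases solvable_or_certificate (ι := Option (V → Bool))
    (fun o => o.elim (-L p q)
      fun c => L (fun i => bit (c i)) (fun e => bit (c e.tail) * bit (c e.head)))
    (fun o => o.elim (-t) f) with ⟨⟨lam, α, β⟩, h⟩ | ⟨u, hu, h0, hpos⟩
  · refine Or.inl ⟨lam, α, β, fun c => h (some c), ?_⟩
    have := h none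
    simp only [Option.elim, LinearMap.neg_apply, hL] at this
    linarith
  · refine Or.inr ⟨fun c => u (some c), u none, fun c => hu _, hu _, fun lam α β => ?_, ?_⟩
    · have := h0 (lam, α, β)
      simp only [Fintype.sum_option, Option.elim, LinearMap.neg_apply, hL] at this
      simp only [quad]
      linarith
    · simp only [Fintype.sum_option, Option.elim] at hpos
      linarith

/-- On a tree, consistent bivariate marginals are marginals of a joint distribution: a quadratic
function that is nonnegative on `{0,1}^V` has a certificate, hence a nonnegative value at them. -/
theorem Theta_nonempty (hG : G.IsTree) (r : V) {p : V → ℝ} {q : Sym2 V → ℝ}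
    (h : AreMarginals G p q) : (Theta G p q).Nonempty := by
  rcases exists_quad_or_masses p (arcProb r G q) 0 (-1) with
    ⟨lam, α, β, hc, hv⟩ | ⟨u, m, hu, -, hum, hpos⟩
  · have := (hasCertificate_of_nonneg hG hc).value_nonneg h.1
      (q := arcProb r G q) fun e => h.2 _ _ e.2.1
    linarith
  · simp only [Pi.zero_apply, mul_zero, Finset.sum_const_zero] at hpos
    exact ⟨_, div_mem_Theta hG hu (by linarith) hum⟩

theorem isCompact_Theta (p : V → ℝ) (q : Sym2 V → ℝ) : IsCompact (Theta G p q) := by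
  refine (isCompact_stdSimplex ℝ (V → Bool)).inter_right (t := {θ |
    (∀ i, prob θ {c | c i = true} = p i) ∧
    (∀ i j, G.Adj i j → prob θ {c | c i = true ∧ c j = true} = q s(i, j))}) ?_
  simp only [Set.ofPred_and, Set.ofPred_forall]
  refine IsClosed.inter (isClosed_iInter fun i => ?_) (isClosed_iInter fun i => isClosed_iInter
    fun j => isClosed_iInter fun _ => ?_)
  · exact isClosed_eq (continuous_prob _) continuous_const
  · exact isClosed_eq (continuous_prob _) continuous_const

/-- The largest probability of an event is attained, and so is the optimum of the dual program: a
certificate that no dual solution reaches it would be a distribution that exceeds it. -/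
theorem exists_isGreatest_prob (hG : G.IsTree) (r : V) {p : V → ℝ} {q : Sym2 V → ℝ}
    (h : AreMarginals G p q) (A : Set (V → Bool)) :
    ∃ U, IsGreatest ((fun θ => prob θ A) '' Theta G p q) U ∧
      ∃ (lam : ℝ) (α : V → ℝ) (β : Arc G r → ℝ), (∀ c, A.indicator 1 c ≤ quad lam α β c) ∧
        value lam α β p (arcProb r G q) = U := by
  obtain ⟨θ, hθ, hmax⟩ := (isCompact_Theta p q).exists_isMaxOn (Theta_nonempty hG r h)
    (continuous_prob A).continuousOn
  refine ⟨prob θ A, ⟨⟨θ, hθ, rfl⟩, ?_⟩, ?_⟩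
  · rintro _ ⟨θ', hθ', rfl⟩
    exact hmax hθ'
  rcases exists_quad_or_masses p (arcProb r G q) (A.indicator 1) (prob θ A) with
    ⟨lam, α, β, hc, hv⟩ | ⟨u, m, hu, hm, hum, hpos⟩
  · exact ⟨lam, α, β, hc, le_antisymm hv (prob_le_value hθ hc)⟩
  · exfalso
    rcases hm.eq_or_lt with rfl | hm
    · -- total mass zero
      have h1 := hum 1 0 0
      simp only [quad, value, Pi.zero_apply, zero_mul, Finset.sum_const_zero, add_zero,
        mul_one] at h1
      have h2 := (Finset.sum_eq_zero_iff_of_nonneg fun c _ => hu c).mp h1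
      rw [Finset.sum_eq_zero fun c hc => by rw [h2 c hc, zero_mul]] at hpos
      simp at hpos
    · have h1 := hmax (div_mem_Theta hG hu hm hum)
      simp only [Set.mem_ofPred_eq, prob_eq_sum (fun c => u c / m), div_mul_eq_mul_div] at h1
      rw [← Finset.sum_div, div_le_iff₀ hm] at h1
      linarith

end Duality

/-! ### Weights of sub-trees -/

section Weight

variable {V : Type u} [Fintype V] [LinearOrder V] {G : SimpleGraph V} {r : V}

/-- The part of the quadratic function `∑ α_i c_i + ∑ β_ij c_i c_j` that lives on `T(i,s)`. An edge
belongs to `T(i,s)` if its lower end is a vertex of `T(i,s)` other than `i`. -/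
noncomputable def weight (α : V → ℝ) (β : Arc G r → ℝ) (i : V) (s : ℕ) (c : V → Bool) : ℝ :=
  ∑ v ∈ verts G r i s, α v * bit (c v) +
    ∑ e : Arc G r with e.head ∈ (verts G r i s).erase i, β e * (bit (c e.tail) * bit (c e.head))

variable (G r) in
/-- The number of coordinates equal to `1` among those of `T(i,s)`. -/
noncomputable def count (i : V) (s : ℕ) (c : V → Bool) : ℕ := ∑ v ∈ verts G r i s, (c v).toNat

/-- The possible numbers `t` of ones in a `0-1` vector of `N` coordinates with one of them fixed to
be `y`. -/
def InRange (N : ℕ) (y : Bool) (t : ℕ) : Prop := y.toNat ≤ t ∧ t + 1 ≤ N + y.toNat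

theorem inRange_count (i : V) (s : ℕ) (c : V → Bool) :
    InRange (size G r i s) (c i) (count G r i s c) := by
  have h1 := Finset.add_sum_erase _ (fun v => (c v).toNat) (self_mem_verts (G := G) (r := r) i s)
  have h2 : ∑ v ∈ (verts G r i s).erase i, (c v).toNat ≤ ((verts G r i s).erase i).card := by
    refine (Finset.sum_le_card_nsmul _ _ 1 fun v _ => Bool.toNat_le _).trans ?_
    simp
  have h3 := Finset.card_erase_add_one (self_mem_verts (G := G) (r := r) i s)
  rw [card_verts] at h3
  unfold InRange count
  omega

theorem exists_count_eq {i : V} {s : ℕ} {y : Bool} {t : ℕ} (h : InRange (size G r i s) y t) :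
    ∃ c : V → Bool, c i = y ∧ count G r i s c = t := by
  have h3 := Finset.card_erase_add_one (self_mem_verts (G := G) (r := r) i s)
  rw [card_verts] at h3
  obtain ⟨T, hT, hcard⟩ := Finset.exists_subset_card_eq (s := (verts G r i s).erase i)
    (n := t - y.toNat) (by unfold InRange at h; omega)
  refine ⟨fun v => if v = i then y else decide (v ∈ T), by simp, ?_⟩
  rw [count, ← Finset.add_sum_erase _ _ (self_mem_verts i s)]
  have e : ∑ v ∈ (verts G r i s).erase i, (if v = i then y else decide (v ∈ T)).toNat = T.card := by
    have : ∀ v ∈ (verts G r i s).erase i,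
        (if v = i then y else decide (v ∈ T)).toNat = if v ∈ T then 1 else 0 := fun v hv => by
      rw [if_neg (Finset.ne_of_mem_erase hv)]
      by_cases hv : v ∈ T <;> simp [hv]
    rw [Finset.sum_congr rfl this, Finset.sum_boole, Nat.cast_id,
      Finset.filter_mem_eq_inter, Finset.inter_eq_right.mpr hT]
  rw [e, hcard, if_pos rfl]
  have := h.1
  omega

theorem count_le (i : V) (s : ℕ) (c : V → Bool) : count G r i s c ≤ Fintype.card V := by
  have h1 := (inRange_count (G := G) (r := r) i s c).2
  have h2 := size_le G r i s
  have h3 : (c i).toNat ≤ 1 := Bool.toNat_le _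
  omega

theorem count_congr {i : V} {s : ℕ} {c c' : V → Bool} (h : ∀ v ∈ verts G r i s, c v = c' v) :
    count G r i s c = count G r i s c' :=
  Finset.sum_congr rfl fun v hv => by rw [h v hv]

theorem weight_congr (hG : G.IsTree) (α : V → ℝ) (β : Arc G r → ℝ) {i : V} {s : ℕ}
    {c c' : V → Bool} (h : ∀ v ∈ verts G r i s, c v = c' v) :
    weight α β i s c = weight α β i s c' := by
  unfold weight
  congr 1
  · exact Finset.sum_congr rfl fun v hv => by rw [h v hv]
  · refine Finset.sum_congr rfl fun e he => ?_
    obtain ⟨hne, hm⟩ := Finset.mem_erase.mp (Finset.mem_filter.mp he).2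
    rw [h _ hm, h e.tail (parent_mem_verts hG hm hne e.2)]

theorem count_succ (hG : G.IsTree) (i : V) (s : ℕ) (h : s + 1 ≤ deg G r i) (c : V → Bool) :
    count G r i (s + 1) c = count G r i s c + count G r (child G r i (s + 1) (by omega) h)
      (deg G r (child G r i (s + 1) (by omega) h)) c := by
  rw [count, verts_succ i s h, Finset.sum_union (disjoint_verts hG i s h)]
  rfl

theorem weight_succ (hG : G.IsTree) (α : V → ℝ) (β : Arc G r → ℝ) (i : V) (s : ℕ)
    (h : s + 1 ≤ deg G r i) (c : V → Bool) :
    weight α β i (s + 1) c = weight α β i s c + weight α β (child G r i (s + 1) (by omega) h)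
      (deg G r (child G r i (s + 1) (by omega) h)) c
      + β (arcTo G r i (s + 1) (by omega) h)
        * (bit (c i) * bit (c (child G r i (s + 1) (by omega) h))) := by
  classical
  set e₀ := arcTo G r i (s + 1) (by omega) h
  set j := child G r i (s + 1) (by omega) h
  have hd := disjoint_verts hG i s h
  have hj : j ∈ verts G r j (deg G r j) := self_mem_verts _ _
  have hij : i ∉ verts G r j (deg G r j) := Finset.disjoint_left.mp hd (self_mem_verts i s)
  have hhead : ∀ e : Arc G r, e.head = j → e = e₀ := fun _ hc => arc_ext hG (e' := e₀) hc
  have e1 : (Finset.univ.filter fun e : Arc G r => e.head ∈ (verts G r i (s + 1)).erase i)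
      = (Finset.univ.filter fun e : Arc G r => e.head ∈ (verts G r i s).erase i) ∪
        insert e₀ (Finset.univ.filter fun e : Arc G r =>
          e.head ∈ (verts G r j (deg G r j)).erase j) := by
    ext e
    have h0 : e = e₀ ↔ e.head = j := ⟨fun hc => by rw [hc]; rfl, hhead e⟩
    simp only [Finset.mem_filter, Finset.mem_univ, true_and, Finset.mem_erase, Finset.mem_union,
      Finset.mem_insert, h0, verts_succ i s h]
    by_cases hc : e.head = j
    · rw [hc]
      have : j ≠ i := fun hc => hij (hc ▸ hj)
      exact ⟨fun _ => Or.inr (Or.inl rfl), fun _ => ⟨this, Or.inr hj⟩⟩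
    · have : e.head ∈ verts G r j (deg G r j) → e.head ≠ i := fun h1 h2 => hij (h2 ▸ h1)
      tauto
  have hdis : Disjoint (Finset.univ.filter fun e : Arc G r => e.head ∈ (verts G r i s).erase i)
      (insert e₀ (Finset.univ.filter fun e : Arc G r =>
          e.head ∈ (verts G r j (deg G r j)).erase j)) := by
    rw [Finset.disjoint_left]
    intro e he he'
    have he := Finset.mem_of_mem_erase (Finset.mem_filter.mp he).2
    refine Finset.disjoint_left.mp hd he ?_
    rcases Finset.mem_insert.mp he' with rfl | he'
    · exact hj
    · exact Finset.mem_of_mem_erase (Finset.mem_filter.mp he').2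
  have hnot : e₀ ∉ Finset.univ.filter fun e : Arc G r =>
      e.head ∈ (verts G r j (deg G r j)).erase j := fun hc =>
    Finset.ne_of_mem_erase (Finset.mem_filter.mp hc).2 rfl
  unfold weight
  rw [e1, Finset.sum_union hdis, Finset.sum_insert hnot, verts_succ i s h, Finset.sum_union hd]
  have e2 : e₀.tail = i := rfl
  have e3 : e₀.head = j := rfl
  rw [e2, e3]
  ring

theorem weight_of_eq_false (α : V → ℝ) (β : Arc G r → ℝ) {i : V} {s : ℕ} {c : V → Bool}
    (h : ∀ v ∈ (verts G r i s).erase i, c v = false) : weight α β i s c = α i * bit (c i) := by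
  rw [weight, ← Finset.add_sum_erase _ _ (self_mem_verts i s), Finset.sum_eq_zero fun v hv => by
    rw [h v hv, bit_false, mul_zero], Finset.sum_eq_zero fun e he => by
    rw [h _ (Finset.mem_filter.mp he).2, bit_false, mul_zero, mul_zero], add_zero, add_zero]

theorem weight_zero (α : V → ℝ) (β : Arc G r → ℝ) (i : V) (c : V → Bool) :
    weight α β i 0 c = α i * bit (c i) :=
  weight_of_eq_false α β (by simp [verts_zero])

theorem count_zero (i : V) (c : V → Bool) : count G r i 0 c = (c i).toNat := by
  simp [count, verts_zero]

theorem quad_eq_add_weight (hG : G.IsTree) (lam : ℝ) (α : V → ℝ) (β : Arc G r → ℝ)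
    (c : V → Bool) : quad lam α β c = lam + weight α β r (deg G r r) c := by
  have h : (Finset.univ.filter fun e : Arc G r => e.head ∈ (Finset.univ : Finset V).erase r)
      = Finset.univ := Finset.filter_true_of_mem fun e _ => Finset.mem_erase.mpr ⟨fun hc => by
        have : G.dist r e.head = G.dist r e.tail + 1 := e.2.2
        rw [hc, SimpleGraph.dist_self] at this
        omega, Finset.mem_univ _⟩
  rw [weight, verts_root hG, h, quad, value, add_assoc]

theorem mem_atLeast_iff (hG : G.IsTree) {k : ℤ} {c : V → Bool} :
    c ∈ atLeast V k ↔ k ≤ count G r r (deg G r r) c := by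
  rw [count, verts_root hG, atLeast, Set.mem_ofPred_eq]
  push_cast
  rfl

/-! ### Least weights with a given number of ones -/

variable (G r) in
/-- The `0-1` vectors with `c_i = y` and `t` ones in `T(i,s)`. -/
noncomputable def configs (i : V) (s : ℕ) (y : Bool) (t : ℕ) : Finset (V → Bool) :=
  Finset.univ.filter fun c => c i = y ∧ count G r i s c = t

theorem mem_configs {i : V} {s : ℕ} {y : Bool} {t : ℕ} {c : V → Bool} :
    c ∈ configs G r i s y t ↔ c i = y ∧ count G r i s c = t := by
  simp [configs]

open Classical in
/-- The least weight of `T(i,s)` over the `0-1` vectors with `c_i = y` and `t` ones in `T(i,s)`; it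
is `z` if there are none. -/
noncomputable def minWeight (α : V → ℝ) (β : Arc G r → ℝ) (z : ℝ) (i : V) (s : ℕ) (y : Bool)
    (t : ℕ) : ℝ :=
  if h : (configs G r i s y t).Nonempty then (configs G r i s y t).inf' h (weight α β i s) else z

theorem minWeight_le (α : V → ℝ) (β : Arc G r → ℝ) (z : ℝ) {i : V} {s : ℕ} {y : Bool} {t : ℕ}
    {c : V → Bool} (h : c ∈ configs G r i s y t) :
    minWeight α β z i s y t ≤ weight α β i s c := by
  rw [minWeight, dif_pos ⟨c, h⟩]
  exact Finset.inf'_le _ h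

theorem exists_minWeight_eq (α : V → ℝ) (β : Arc G r → ℝ) (z : ℝ) {i : V} {s : ℕ} {y : Bool}
    {t : ℕ} (h : (configs G r i s y t).Nonempty) :
    ∃ c ∈ configs G r i s y t, minWeight α β z i s y t = weight α β i s c := by
  rw [minWeight, dif_pos h]
  exact Finset.exists_mem_eq_inf' h _

theorem configs_nonempty {i : V} {s : ℕ} {y : Bool} {t : ℕ} (h : InRange (size G r i s) y t) :
    (configs G r i s y t).Nonempty :=
  let ⟨c, hc⟩ := exists_count_eq h
  ⟨c, mem_configs.mpr hc⟩

/-- One step of the dynamic program: optimal vectors on `T(i,s)` and on the full sub-tree of the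
next child are glued together. -/
theorem minWeight_succ_le (hG : G.IsTree) (α : V → ℝ) (β : Arc G r → ℝ) (z : ℝ) {i : V} {s : ℕ}
    (h : s + 1 ≤ deg G r i) {y b : Bool} {t a : ℕ} (ht : InRange (size G r i s) y t)
    (ha : InRange (fullSize G r (child G r i (s + 1) (by omega) h)) b a) :
    minWeight α β z i (s + 1) y (t + a) ≤ minWeight α β z i s y t
      + minWeight α β z (child G r i (s + 1) (by omega) h)
        (deg G r (child G r i (s + 1) (by omega) h)) b a
      + β (arcTo G r i (s + 1) (by omega) h) * (bit y * bit b) := by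
  obtain ⟨c, hc, e⟩ := exists_minWeight_eq α β z (configs_nonempty ht)
  obtain ⟨c', hc', e'⟩ := exists_minWeight_eq α β z (configs_nonempty ha)
  rw [e, e']
  rw [mem_configs] at hc hc'
  have hd := disjoint_verts hG i s h
  set j := child G r i (s + 1) (by omega) h
  have h1 : ∀ v ∈ verts G r i s,
      (if v ∈ verts G r i s then c v else c' v) = c v := fun v hv => if_pos hv
  have h2 : ∀ v ∈ verts G r j (deg G r j),
      (if v ∈ verts G r i s then c v else c' v) = c' v :=
    fun v hv => if_neg (Finset.disjoint_right.mp hd hv)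
  have hw := weight_succ hG α β i s h fun v => if v ∈ verts G r i s then c v else c' v
  rw [h1 i (self_mem_verts i s), h2 j (self_mem_verts j _), hc.1, hc'.1, weight_congr hG α β h1,
    weight_congr hG α β h2] at hw
  rw [← hw]
  refine minWeight_le α β z (mem_configs.mpr ⟨?_, ?_⟩)
  · rw [h1 i (self_mem_verts i s), hc.1]
  · rw [count_succ hG i s h, count_congr h1, count_congr h2, hc.2, hc'.2]

theorem minWeight_toNat (α : V → ℝ) (β : Arc G r → ℝ) (z : ℝ) (i : V) (s : ℕ) (y : Bool) :
    minWeight α β z i s y y.toNat = α i * bit y := by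
  have hpos : 1 ≤ size G r i s := by
    rw [← card_verts]
    exact Finset.card_pos.mpr ⟨i, self_mem_verts i s⟩
  obtain ⟨c, hc, e⟩ := exists_minWeight_eq α β z
    (configs_nonempty (G := G) (r := r) (i := i) (s := s) (y := y) (t := y.toNat)
      ⟨le_rfl, by omega⟩)
  obtain ⟨hy, ht⟩ := mem_configs.mp hc
  rw [e, ← hy]
  refine weight_of_eq_false α β fun v hv => ?_
  rw [count, ← Finset.add_sum_erase _ _ (self_mem_verts i s), hy, Nat.add_eq_left,
    Finset.sum_eq_zero_iff] at ht
  exact Bool.toNat_eq_zero.mp (ht v hv)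

end Weight

/-! ### Feasible points of the compact linear program -/

section Feasible

variable {V : Type u} [Fintype V] [LinearOrder V] {G : SimpleGraph V} {r : V}

open Classical in
/-- The value of the variable `x_{i,s,y,t}` at the point `v`, extended by zero to all indices, so
that the index `t` can be rewritten. -/
noncomputable def xval (v : Var G r → ℝ) (i : V) (s : ℕ) (y : Bool) (t : ℕ) : ℝ :=
  if h : s ≤ deg G r i ∧ t ≤ Fintype.card V then v (.x i s y t h.1 h.2) else 0

theorem apply_x (v : Var G r → ℝ) (i : V) (s : ℕ) (y : Bool) (t : ℕ) (hs : s ≤ deg G r i)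
    (ht : t ≤ Fintype.card V) : v (.x i s y t hs ht) = xval v i s y t := by
  rw [xval, dif_pos ⟨hs, ht⟩]

theorem xval_zero {k : ℤ} {v : Var G r → ℝ} (hv : ∀ c : Con G r k, (conOf k c).Holds v) (i : V)
    (y : Bool) : xval v i 0 y y.toNat = v (.alpha i) * bit y := by
  cases y
  · have := hv (.base0 i 0 (Nat.zero_le _))
    simp only [conOf, LinConstraint.Holds, X, val, LinearMap.proj_apply, apply_x] at this
    simp [this]
  · have := hv (.base1 i 0 (Nat.zero_le _))
    simp only [conOf, LinConstraint.Holds, X, val, LinearMap.proj_apply, apply_x,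
      LinearMap.sub_apply] at this
    simp
    linarith

/-- The four groups of constraints for the first child and the four groups for the later children
are one and the same step of the dynamic program, since `T(i,0)` is a single vertex. -/
theorem xval_succ_le (hG : G.IsTree) {k : ℤ} {v : Var G r → ℝ}
    (hv : ∀ c : Con G r k, (conOf k c).Holds v) {i : V} {s : ℕ} (h : s + 1 ≤ deg G r i)
    {y b : Bool} {t a : ℕ} (ht : InRange (size G r i s) y t)
    (ha : InRange (fullSize G r (child G r i (s + 1) (by omega) h)) b a) :
    xval v i (s + 1) y (t + a) ≤ xval v i s y t
      + xval v (child G r i (s + 1) (by omega) h)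
        (deg G r (child G r i (s + 1) (by omega) h)) b a
      + v (.beta (arcTo G r i (s + 1) (by omega) h)) * (bit y * bit b) := by
  have hsize := size_succ hG i s h
  unfold InRange at ht ha
  rcases Nat.eq_zero_or_pos s with rfl | hs
  · rw [size_zero] at ht hsize
    obtain rfl : t = y.toNat := by omega
    rw [xval_zero hv]
    change size G r i 1 = _ at hsize
    cases y <;> cases b <;> simp only [Bool.toNat_false, Bool.toNat_true] at ht ha ⊢
    · have := hv (.first00 i h a (by omega))
      simp only [conOf, LinConstraint.Holds, X, Xfull, val, LinearMap.proj_apply, apply_x,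
        LinearMap.sub_apply] at this
      simp
      linarith
    · have := hv (.first01 i h a (by omega) (by omega))
      simp only [conOf, LinConstraint.Holds, X, Xfull, val, LinearMap.proj_apply, apply_x,
        LinearMap.sub_apply] at this
      simp
      linarith
    · have := hv (.first10 i h (1 + a) (by omega) (by omega))
      simp only [conOf, LinConstraint.Holds, X, Xfull, val, LinearMap.proj_apply, apply_x,
        LinearMap.sub_apply, LinearMap.add_apply, Nat.add_sub_cancel_left] at this
      simp
      linarith
    · have := hv (.first11 i h (1 + a) (by omega) (by omega))
      simp only [conOf, LinConstraint.Holds, X, Xfull, val, LinearMap.proj_apply, apply_x,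
        LinearMap.sub_apply, LinearMap.add_apply, Nat.add_sub_cancel_left] at this
      simp
      linarith
  · cases y <;> cases b <;> simp only [Bool.toNat_false, Bool.toNat_true] at ht ha
    · have := hv (.next00 i (s + 1) (by omega) h (t + a) (by omega) a
        (by simp only [Nat.add_sub_cancel]; omega) (by omega) (by omega))
      simp only [conOf, LinConstraint.Holds, X, Xfull, val, LinearMap.proj_apply, apply_x,
        LinearMap.sub_apply, LinearMap.add_apply, Nat.add_sub_cancel] at this
      simp
      linarith
    · have := hv (.next01 i (s + 1) (by omega) h (t + a) (by omega) (by omega) a (by omega)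
        (by simp only [Nat.add_sub_cancel]; omega) (by omega) (by omega))
      simp only [conOf, LinConstraint.Holds, X, Xfull, val, LinearMap.proj_apply, apply_x,
        LinearMap.sub_apply, LinearMap.add_apply, Nat.add_sub_cancel] at this
      simp
      linarith
    · have := hv (.next10 i (s + 1) (by omega) h (t + a) (by omega) (by omega) a
        (by simp only [Nat.add_sub_cancel]; omega) (by omega) (by omega))
      simp only [conOf, LinConstraint.Holds, X, Xfull, val, LinearMap.proj_apply, apply_x,
        LinearMap.sub_apply, LinearMap.add_apply, Nat.add_sub_cancel] at this
      simp
      linarith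
    · have := hv (.next11 i (s + 1) (by omega) h (t + a) (by omega) (by omega) a (by omega)
        (by simp only [Nat.add_sub_cancel]; omega) (by omega) (by omega))
      simp only [conOf, LinConstraint.Holds, X, Xfull, val, LinearMap.proj_apply, apply_x,
        LinearMap.sub_apply, LinearMap.add_apply, Nat.add_sub_cancel] at this
      simp
      linarith

/-- At a feasible point, the variables `x` are lower bounds for the weights of the sub-trees. -/
theorem xval_le_weight (hG : G.IsTree) {k : ℤ} {v : Var G r → ℝ}
    (hv : ∀ c : Con G r k, (conOf k c).Holds v) (c : V → Bool) (i : V) (s : ℕ)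
    (hs : s ≤ deg G r i) :
    xval v i s (c i) (count G r i s c)
      ≤ weight (fun i => v (.alpha i)) (fun e => v (.beta e)) i s c := by
  refine subtree_induction hG (P := fun i s => xval v i s (c i) (count G r i s c)
    ≤ weight (fun i => v (.alpha i)) (fun e => v (.beta e)) i s c) (fun i => ?_)
    (fun i s h ih1 ih2 => ?_) i s hs
  · rw [count_zero, xval_zero hv, weight_zero]
  · rw [count_succ hG i s h, weight_succ hG _ _ i s h]
    have := xval_succ_le hG hv h (inRange_count i s c) (inRange_count _ _ c)
    linarith

theorem quad_nonneg_of_feasible {k : ℤ} {v : Var G r → ℝ}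
    (hv : ∀ c : Con G r k, (conOf k c).Holds v) (c : V → Bool) :
    0 ≤ quad (v .lam) (fun i => v (.alpha i)) (fun e => v (.beta e)) c := by
  refine HasCertificate.quad_nonneg ⟨fun i => v (.tau i), fun e => v (.Delta e),
    fun e => v (.eta e), fun e => v (.gamma e), fun e => v (.chi e), fun i => hv (.tauNonneg i),
    fun e => hv (.DeltaNonneg e), fun e => hv (.etaNonneg e), fun e => hv (.gammaNonneg e),
    fun e => hv (.chiNonneg e), ?_, fun i => ?_, fun e => hv (.edgeGe e)⟩ c
  · simpa [conOf, LinConstraint.Holds, val, LinearMap.sum_apply] using hv .lamGe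
  · simpa only [conOf, LinConstraint.Holds, val, LinearMap.sum_apply, LinearMap.add_apply,
      LinearMap.sub_apply, LinearMap.proj_apply] using hv (.vertexGe i)

theorem indicator_le_quad_of_feasible (hG : G.IsTree) {k : ℤ} {v : Var G r → ℝ}
    (hv : ∀ c : Con G r k, (conOf k c).Holds v) (c : V → Bool) :
    (atLeast V k).indicator 1 c
      ≤ quad (v .lam) (fun i => v (.alpha i)) (fun e => v (.beta e)) c := by
  classical
  by_cases hc : c ∈ atLeast V k
  · rw [Set.indicator_of_mem hc, Pi.one_apply, quad_eq_add_weight hG]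
    have h1 := xval_le_weight hG hv c r _ le_rfl
    have h2 := hv .lamZ
    have h3 : v .z ≤ xval v r (deg G r r) (c r) (count G r r (deg G r r) c) := by
      have hk := (mem_atLeast_iff (r := r) hG).mp hc
      have hn := count_le (G := G) (r := r) r (deg G r r) c
      cases c r
      · have := hv (.root0 _ hk hn)
        simp only [conOf, LinConstraint.Holds, X, Xfull, val, LinearMap.proj_apply, apply_x,
          LinearMap.sub_apply] at this
        linarith
      · have := hv (.root1 _ hk hn)
        simp only [conOf, LinConstraint.Holds, X, Xfull, val, LinearMap.proj_apply, apply_x,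
          LinearMap.sub_apply] at this
        linarith
    simp only [conOf, LinConstraint.Holds, val, LinearMap.proj_apply, LinearMap.add_apply] at h2
    linarith
  · rw [Set.indicator_of_notMem hc]
    exact quad_nonneg_of_feasible hv c

/-- A quadratic function that majorizes the indicator of `∑ c_i ≥ k` extends to a feasible point:
the variables `x` are the least weights, and `z = 1 - λ`. The least weights without a `0-1` vector
that realizes them occur only in the constraints for the root, where the value `z` does. -/
theorem exists_feasible (hG : G.IsTree) (k : ℤ) {lam : ℝ} {α : V → ℝ} {β : Arc G r → ℝ}
    (h : ∀ c, (atLeast V k).indicator 1 c ≤ quad lam α β c) :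
    ∃ v : Var G r → ℝ, (∀ c : Con G r k, (conOf k c).Holds v) ∧ v .lam = lam ∧
      (∀ i, v (.alpha i) = α i) ∧ ∀ e, v (.beta e) = β e := by
  classical
  obtain ⟨τ, Δ, η, γ, χ, hτ, hΔ, hη, hγ, hχ, hl, hvx, he⟩ :=
    hasCertificate_of_nonneg hG fun c =>
      (Set.indicator_nonneg (fun _ _ => zero_le_one) c).trans (h c)
  have hroot (y : Bool) (t : ℕ) (hk : k ≤ t) :
      1 - lam ≤ minWeight α β (1 - lam) r (deg G r r) y t := by
    by_cases hne : (configs G r r (deg G r r) y t).Nonempty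
    · obtain ⟨c, hc, e⟩ := exists_minWeight_eq α β (1 - lam) hne
      have hmem : c ∈ atLeast V k := by
        rw [mem_atLeast_iff hG, (mem_configs.mp hc).2]
        exact hk
      have := h c
      rw [Set.indicator_of_mem hmem, Pi.one_apply, quad_eq_add_weight hG] at this
      linarith
    · rw [minWeight, dif_neg hne]
  let v : Var G r → ℝ
    | .lam => lam
    | .z => 1 - lam
    | .alpha i => α i
    | .tau i => τ i
    | .beta e => β e
    | .Delta e => Δ e
    | .eta e => η e
    | .gamma e => γ e
    | .chi e => χ e
    | .x i s y t _ _ => minWeight α β (1 - lam) i s y t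
  have hfirst (i : V) (hi : 1 ≤ deg G r i) (y b : Bool) (a : ℕ)
      (ha : InRange (fullSize G r (child G r i 1 le_rfl hi)) b a) :
      minWeight α β (1 - lam) i 1 y (y.toNat + a) ≤ α i * bit y
        + minWeight α β (1 - lam) (child G r i 1 le_rfl hi)
          (deg G r (child G r i 1 le_rfl hi)) b a
        + β (arcTo G r i 1 le_rfl hi) * (bit y * bit b) := by
    rw [← minWeight_toNat α β (1 - lam) i 0 y]
    exact minWeight_succ_le hG α β (1 - lam) hi ⟨le_rfl, by rw [size_zero]; omega⟩ ha
  have hsize (i : V) (hi : 1 ≤ deg G r i) :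
      size G r i 1 = 1 + fullSize G r (child G r i 1 le_rfl hi) := by
    have := size_succ hG i 0 hi
    rwa [size_zero] at this
  refine ⟨v, fun c => ?_, rfl, fun i => rfl, fun e => rfl⟩
  cases c with
  | lamGe => simpa [conOf, LinConstraint.Holds, val, LinearMap.sum_apply, v] using hl
  | vertexGe i =>
    simpa only [conOf, LinConstraint.Holds, val, LinearMap.sum_apply, LinearMap.add_apply,
      LinearMap.sub_apply, LinearMap.proj_apply, v] using hvx i
  | edgeGe e => exact he e
  | lamZ => simp [conOf, LinConstraint.Holds, val, v]
  | root0 t hk ht => exact sub_nonneg.mpr (hroot false t hk)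
  | root1 t hk ht => exact sub_nonneg.mpr (hroot true t hk)
  | base0 i s hs =>
    have := minWeight_toNat α β (1 - lam) i s false
    simpa [conOf, LinConstraint.Holds, X, val, v] using this
  | base1 i s hs =>
    have := minWeight_toNat α β (1 - lam) i s true
    simpa [conOf, LinConstraint.Holds, X, val, v, sub_eq_zero] using this
  | first00 i hi t ht =>
    have h1 := hsize i hi
    have := hfirst i hi false false t ⟨by simp, by simp only [Bool.toNat_false]; omega⟩
    simpa [conOf, LinConstraint.Holds, X, Xfull, val, v] using this
  | first01 i hi t h1 ht =>
    have h1 := hsize i hi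
    have := hfirst i hi false true t ⟨by simpa, by simp only [Bool.toNat_true]; omega⟩
    simpa [conOf, LinConstraint.Holds, X, Xfull, val, v] using this
  | first10 i hi t h1 ht =>
    have h1 := hsize i hi
    have := hfirst i hi true false (t - 1) ⟨by simp, by simp only [Bool.toNat_false]; omega⟩
    rw [Bool.toNat_true, Nat.add_sub_cancel' (by omega)] at this
    simp only [bit_true, bit_false] at this
    simp only [conOf, LinConstraint.Holds, X, Xfull, val, v, LinearMap.proj_apply,
      LinearMap.sub_apply, LinearMap.add_apply]
    linarith
  | first11 i hi t h1 ht =>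
    have h1 := hsize i hi
    have := hfirst i hi true true (t - 1)
      ⟨by simp only [Bool.toNat_true]; omega, by simp only [Bool.toNat_true]; omega⟩
    rw [Bool.toNat_true, Nat.add_sub_cancel' (by omega)] at this
    simp only [bit_true] at this
    simp only [conOf, LinConstraint.Holds, X, Xfull, val, v, LinearMap.proj_apply,
      LinearMap.sub_apply, LinearMap.add_apply]
    linarith
  | next00 i s hs2 hs t ht a hmin hmax hat =>
    obtain ⟨s, rfl⟩ : ∃ m, s = m + 1 := ⟨s - 1, by omega⟩
    rw [Nat.add_sub_cancel] at hmin
    have := minWeight_succ_le hG α β (1 - lam) hs (y := false) (b := false) (t := t - a) (a := a)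
      ⟨by simp, by simp only [Bool.toNat_false]; omega⟩ ⟨by simp, by simpa⟩
    rw [Nat.sub_add_cancel hat] at this
    simpa [conOf, LinConstraint.Holds, X, Xfull, val, v] using this
  | next01 i s hs2 hs t h1 ht a ha hmin hmax hat =>
    obtain ⟨s, rfl⟩ : ∃ m, s = m + 1 := ⟨s - 1, by omega⟩
    rw [Nat.add_sub_cancel] at hmin
    have := minWeight_succ_le hG α β (1 - lam) hs (y := false) (b := true) (t := t - a) (a := a)
      ⟨by simp, by simp only [Bool.toNat_false]; omega⟩ ⟨by simpa, by simpa⟩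
    rw [Nat.sub_add_cancel hat] at this
    simpa [conOf, LinConstraint.Holds, X, Xfull, val, v] using this
  | next10 i s hs2 hs t h1 ht a hmin hmax hat =>
    obtain ⟨s, rfl⟩ : ∃ m, s = m + 1 := ⟨s - 1, by omega⟩
    rw [Nat.add_sub_cancel] at hmin
    have := minWeight_succ_le hG α β (1 - lam) hs (y := true) (b := false) (t := t - a) (a := a)
      ⟨by simp only [Bool.toNat_true]; omega, by simp only [Bool.toNat_true]; omega⟩
      ⟨by simp, by simpa⟩
    rw [Nat.sub_add_cancel (by omega)] at this
    simpa [conOf, LinConstraint.Holds, X, Xfull, val, v] using this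
  | next11 i s hs2 hs t h1 ht a ha hmin hmax hat =>
    obtain ⟨s, rfl⟩ : ∃ m, s = m + 1 := ⟨s - 1, by omega⟩
    rw [Nat.add_sub_cancel] at hmin
    have := minWeight_succ_le hG α β (1 - lam) hs (y := true) (b := true) (t := t - a) (a := a)
      ⟨by simp only [Bool.toNat_true]; omega, by simp only [Bool.toNat_true]; omega⟩
      ⟨by simpa, by simpa⟩
    rw [Nat.sub_add_cancel (by omega)] at this
    simp only [bit_true] at this
    simp only [conOf, LinConstraint.Holds, X, Xfull, val, v, LinearMap.proj_apply,
      LinearMap.sub_apply, LinearMap.add_apply, Nat.add_sub_cancel]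
    linarith
  | etaNonneg e => exact hη e
  | gammaNonneg e => exact hγ e
  | DeltaNonneg e => exact hΔ e
  | tauNonneg i => exact hτ i
  | chiNonneg e => exact hχ e

theorem objective_apply (p : V → ℝ) (q : Sym2 V → ℝ) (k : ℤ) (v : Var G r → ℝ) :
    (compactLP G r p q k).objective v
      = value (v .lam) (fun i => v (.alpha i)) (fun e => v (.beta e)) p (arcProb r G q) := by
  simp [compactLP, value, arcProb, val, LinearMap.sum_apply, mul_comm]

theorem exists_isTightUpperBound (hG : G.IsTree) (r : V) (k : ℤ) {p : V → ℝ} {q : Sym2 V → ℝ}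
    (h : AreMarginals G p q) :
    ∃ U, IsTightUpperBound G p q k U ∧ (compactLP G r p q k).IsOptimalValue U := by
  obtain ⟨U, hU, lam, α, β, hc, hval⟩ := exists_isGreatest_prob hG r h (atLeast V k)
  refine ⟨U, hU, ?_, ?_⟩
  · obtain ⟨v, hv, h1, h2, h3⟩ := exists_feasible hG k hc
    refine ⟨v, hv, ?_⟩
    rw [objective_apply, ← hval, h1, funext h2, funext h3]
  · rintro _ ⟨v, hv, rfl⟩
    obtain ⟨θ, hθ, rfl⟩ := hU.1
    rw [objective_apply]
    exact prob_le_value hθ (indicator_le_quad_of_feasible hG hv)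

end Feasible

/-! ### The size of the compact linear program -/

section Counting

variable {V : Type u} [Fintype V] [LinearOrder V] {G : SimpleGraph V} {r : V}

open Classical in
/-- A code for the pair `(i,s)` with `s ≤ d_i`: the vertex `i` itself if `s = 0`, and the child
`i(s)` otherwise. -/
noncomputable def pairCode (G : SimpleGraph V) (r i : V) (s : ℕ) : Bool × V :=
  if h : 1 ≤ s ∧ s ≤ deg G r i then (true, child G r i s h.1 h.2) else (false, i)

/-- As every vertex has at most one parent, there are at most `2n` pairs `(i,s)`. -/
theorem pairCode_inj (hG : G.IsTree) {i i' : V} {s s' : ℕ} (hs : s ≤ deg G r i)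
    (hs' : s' ≤ deg G r i') (h : pairCode G r i s = pairCode G r i' s') : i = i' ∧ s = s' := by
  unfold pairCode at h
  split_ifs at h with h1 h2 h2
  · have hc := (Prod.ext_iff.mp h).2
    have c1 := isChild_child G r i s h1.1 h1.2
    have c2 := isChild_child G r i' s' h2.1 h2.2
    simp only at hc
    rw [hc] at c1
    obtain rfl := c1.parent_unique hG c2
    refine ⟨rfl, ?_⟩
    have := (nodup_children (G := G) (r := r) i).getElem_inj_iff.mp hc
    omega
  · simp at h
  · simp at h
  · exact ⟨(Prod.ext_iff.mp h).2, by omega⟩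

/-- A code for the variables: the kind, a vertex or a pair `(i,s)`, and the indices `y`, `t`. -/
noncomputable def varCode : Var G r → ℕ × (Bool × V) × Bool × ℕ
  | .lam => (0, (false, r), false, 0)
  | .z => (1, (false, r), false, 0)
  | .alpha i => (2, (false, i), false, 0)
  | .tau i => (3, (false, i), false, 0)
  | .beta e => (4, (false, e.head), false, 0)
  | .Delta e => (5, (false, e.head), false, 0)
  | .eta e => (6, (false, e.head), false, 0)
  | .gamma e => (7, (false, e.head), false, 0)
  | .chi e => (8, (false, e.head), false, 0)
  | .x i s y t _ _ => (9, pairCode G r i s, y, t)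

theorem varCode_injective (hG : G.IsTree) : Function.Injective (varCode (G := G) (r := r)) := by
  intro a b h
  cases a <;> cases b <;>
    simp only [varCode, Prod.mk.injEq, Nat.reduceEqDiff, OfNat.ofNat_ne_zero,
      OfNat.zero_ne_ofNat, OfNat.ofNat_ne_one, OfNat.one_ne_ofNat, zero_ne_one, one_ne_zero,
      false_and, true_and, and_true] at h
  all_goals first
    | rfl
    | rw [h]
    | rw [arc_ext hG h]
    | (rename_i hs _ _ _ _ _ hs' _
       obtain ⟨h1, rfl, rfl⟩ := h
       obtain ⟨rfl, rfl⟩ := pairCode_inj hG hs hs' h1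
       rfl)

theorem varCode_mem (v : Var G r) : varCode v ∈
    Finset.range 10 ×ˢ (Finset.univ : Finset (Bool × V)) ×ˢ (Finset.univ : Finset Bool) ×ˢ
      Finset.range (Fintype.card V + 1) := by
  cases v <;> (simp [varCode]; try omega)

/-- A code for the constraints: the kind, a vertex or a pair `(i,s)`, and the indices `t`, `a`. -/
noncomputable def conCode {k : ℤ} : Con G r k → ℕ × (Bool × V) × ℕ × ℕ
  | .lamGe => (0, (false, r), 0, 0)
  | .vertexGe i => (1, (false, i), 0, 0)
  | .edgeGe e => (2, (false, e.head), 0, 0)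
  | .lamZ => (3, (false, r), 0, 0)
  | .root0 t _ _ => (4, (false, r), t, 0)
  | .root1 t _ _ => (5, (false, r), t, 0)
  | .base0 i s _ => (6, pairCode G r i s, 0, 0)
  | .base1 i s _ => (7, pairCode G r i s, 0, 0)
  | .first00 i _ t _ => (8, (false, i), t, 0)
  | .first01 i _ t _ _ => (9, (false, i), t, 0)
  | .first10 i _ t _ _ => (10, (false, i), t, 0)
  | .first11 i _ t _ _ => (11, (false, i), t, 0)
  | .next00 i s _ _ t _ a _ _ _ => (12, pairCode G r i s, t, a)
  | .next01 i s _ _ t _ _ a _ _ _ _ => (13, pairCode G r i s, t, a)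
  | .next10 i s _ _ t _ _ a _ _ _ => (14, pairCode G r i s, t, a)
  | .next11 i s _ _ t _ _ a _ _ _ _ => (15, pairCode G r i s, t, a)
  | .etaNonneg e => (16, (false, e.head), 0, 0)
  | .gammaNonneg e => (17, (false, e.head), 0, 0)
  | .DeltaNonneg e => (18, (false, e.head), 0, 0)
  | .tauNonneg i => (19, (false, i), 0, 0)
  | .chiNonneg e => (20, (false, e.head), 0, 0)

theorem conCode_injective (hG : G.IsTree) (k : ℤ) :
    Function.Injective (conCode (G := G) (r := r) (k := k)) := by
  intro a b h
  cases a <;> cases b <;>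
    simp only [conCode, Prod.mk.injEq, Nat.reduceEqDiff, OfNat.ofNat_ne_zero,
      OfNat.zero_ne_ofNat, OfNat.ofNat_ne_one, OfNat.one_ne_ofNat, zero_ne_one, one_ne_zero,
      false_and, true_and, and_true] at h
  all_goals first
    | rfl
    | (subst h; rfl)
    | rw [arc_ext hG h]
    | (obtain ⟨rfl, rfl⟩ := h; rfl)
    | (obtain ⟨rfl, rfl⟩ := pairCode_inj hG ‹_› ‹_› h; rfl)
    | (obtain ⟨h1, rfl, rfl⟩ := h
       obtain ⟨rfl, rfl⟩ := pairCode_inj hG ‹_› ‹_› h1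
       rfl)

theorem conCode_mem {k : ℤ} (c : Con G r k) : conCode c ∈
    Finset.range 21 ×ˢ (Finset.univ : Finset (Bool × V)) ×ˢ
      Finset.range (Fintype.card V + 1) ×ˢ Finset.range (Fintype.card V + 1) := by
  have h (i : V) (s : ℕ) := size_le G r i s
  cases c with
  | next00 i s =>
    have := h i s
    simp [conCode]
    omega
  | next01 i s =>
    have := h i s
    simp [conCode]
    omega
  | next10 i s =>
    have := h i s
    simp [conCode]
    omega
  | next11 i s =>
    have := h i s
    simp [conCode]
    omega
  | first00 i =>
    have := h i 1
    simp [conCode]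
    omega
  | first01 i =>
    have := h i 1
    simp [conCode]
    omega
  | first10 i =>
    have := h i 1
    simp [conCode]
    omega
  | first11 i =>
    have := h i 1
    simp [conCode]
    omega
  | _ => simp [conCode] <;> omega

theorem enat_card_le_of_injective {α β : Type*} {f : α → β} (hf : Function.Injective f)
    (s : Finset β) (hs : ∀ a, f a ∈ s) : ENat.card α ≤ (s.card : ℕ∞) := by
  have : Function.Injective fun a => (⟨f a, hs a⟩ : s) := fun a b h => hf (Subtype.ext_iff.mp h)
  refine (ENat.card_le_card_of_injective this).trans ?_
  simp

theorem card_var_le (hG : G.IsTree) (r : V) :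
    ENat.card (Var G r) ≤ ((200 * Fintype.card V ^ 2 : ℕ) : ℕ∞) := by
  refine (enat_card_le_of_injective (varCode_injective hG) _ varCode_mem).trans ?_
  have h := one_le_card r
  simp only [Finset.card_product, Finset.card_range, Finset.card_univ, Fintype.card_prod,
    Fintype.card_bool, Nat.cast_le]
  nlinarith

theorem card_con_le (hG : G.IsTree) (r : V) (k : ℤ) :
    ENat.card (Con G r k) ≤ ((200 * Fintype.card V ^ 3 : ℕ) : ℕ∞) := by
  refine (enat_card_le_of_injective (conCode_injective hG k) _ conCode_mem).trans ?_
  have h := one_le_card r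
  simp only [Finset.card_product, Finset.card_range, Finset.card_univ, Fintype.card_prod,
    Fintype.card_bool, Nat.cast_le]
  calc 21 * (2 * Fintype.card V * ((Fintype.card V + 1) * (Fintype.card V + 1)))
      ≤ 21 * (2 * Fintype.card V * ((2 * Fintype.card V) * (2 * Fintype.card V))) := by
        gcongr <;> omega
    _ = 168 * Fintype.card V ^ 3 := by ring
    _ ≤ 200 * Fintype.card V ^ 3 := by gcongr; norm_num

end Counting

end TreeBound

theorem theorem2 :
    ∃ C : ℕ, ∀ (V : Type u) [Fintype V] [LinearOrder V] (G : SimpleGraph V) (_ : G.IsTree)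
      (r : V) (k : ℤ),
      ENat.card (TreeBound.Var G r) ≤ ((C * Fintype.card V ^ 2 : ℕ) : ℕ∞) ∧
      ENat.card (TreeBound.Con G r k) ≤ ((C * Fintype.card V ^ 3 : ℕ) : ℕ∞) ∧
      ∀ (p : V → ℝ) (q : Sym2 V → ℝ), TreeBound.AreMarginals G p q →
        ∃ U : ℝ, TreeBound.IsTightUpperBound G p q k U ∧
          (TreeBound.compactLP G r p q k).IsOptimalValue U := by
  refine ⟨200, fun V _ _ G hG r k => ⟨TreeBound.card_var_le hG r, TreeBound.card_con_le hG r k,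
    fun p q h => TreeBound.exists_isTightUpperBound hG r k h⟩⟩
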